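/- \textbf{Setting.} Let $\Lambda_{\mathcal L}=\mathrm{diag}(\lambda^{\mathcal L}_1,\dots,\lambda^{\mathcal L}_D)$ with $\lambda^{\mathcal L}_i\ge 0$ and $\min_i\lambda^{\mathcal L}_i=0$, let $K\ge 1$ be the number of indices with $\lambda^{\mathcal L}_i=0$, and let $x_1,\dots,x_N\in\mathbb R^D$ be the feature vectors of $N\ge1$ arms, $\|x_a\|_2\le 1$. (In particular: for a weighted graph on $N=D$ nodes with symmetric nonnegative weight matrix $W$ and Laplacian $\mathcal L=\mathcal D-W=Q\Lambda_{\mathcal L}Q^{\mathsf T}$, $Q$ orthogonal, $x_a$ is the $a$-th row of $Q$.) Let $\lambda>0$, $R\ge 0$, $C\in\mathbb R$, $\delta\in(0,1)$, let $T\ge 1$ be an integer, $\Lambda=\Lambda_{\mathcal L}+\lambda I$, $\lambda_i=\lambda^{\mathcal L}_i+\lambda$ (so $\lambda$ is the minimum eigenvalue of $\Lambda$), and let \[ d=\left\lceil \frac{\max\{\sum_{i=1}^D\log(1+t_i/\lambda_i)\,:\,t_i\ge 0,\ \sum_i t_i=T\}}{\log(1+T/(K\lambda))}\right\rceil \] be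 the effective dimension. Let $\alpha\in\mathbb R^D$ be an unknown vector. Playing arm $a_t$ in round $t=1,\dots,T$ yields the reward $r_t=x_{a_t}^{\mathsf T}\alpha+\varepsilon_t$, where, conditionally on $(a_s,r_s)_{s<t}$ and $a_t$, the noise $\varepsilon_t$ has mean zero and is $R$-sub-Gaussian: $\mathbb E[e^{s\varepsilon_t}\mid\cdot\,]\le e^{R^2s^2/2}$ for all $s\in\mathbb R$. The regret is $R_T=T\max_a x_a^{\mathsf T}\alpha-\sum_{t=1}^T x_{a_t}^{\mathsf T}\alpha$. SpectralTS sets $v=R\sqrt{3d\log\left(\frac1\delta+\frac{T}{\delta\lambda K}\right)}+C$ and in every round $t$, with $V_t=\Lambda+\sum_{s<t}x_{a_s}x_{a_s}^{\mathsf T}$ and $\hat\alpha_t=V_t^{-1}\sum_{s<t}x_{a_s}r_s$, draws a sample $\tilde\alpha_t$ whose conditional law given $(a_s,r_s)_{s<t}$ is $\mathcal N(\hat\alpha_t,v^2V_t^{-1})$ and plays an arm $a_t\in\arg\max_a x_a^{\mathsf T}\tilde\alpha_t$ (ties broken arbitrarily). \textbf{Theorem.} If $\|\alpha\|_\Lambda=\sqrt{\alpha^{\mathsf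 T}\Lambda\alpha}\le C$ and $x_a^{\mathsf T}\alpha\in[-1,1]$ for all $a$, then with probability at least $1-\delta$ the regret of SpectralTS satisfies \[ R_T\le B:=\frac{11g}{p}\sqrt{\frac{2+2\lambda}{\lambda}\,dT\log\left(1+\frac{T}{K\lambda}\right)}+\frac1T+\frac gp\left(\frac{11}{\sqrt\lambda}+2\right)\sqrt{2T\log\left(\frac2\delta\right)}, \] where $p=1/(4e\sqrt\pi)$ and \[ g=\sqrt{4\log(TN)}\left(R\sqrt{3d\log\left(\frac1\delta+\frac{T}{\delta\lambda K}\right)}+C\right)+R\sqrt{d\log\left(\frac{T^2}{\delta}+\frac{T^3}{\delta\lambda K}\right)}+C. \] Moreover, up to logarithmic factors in $T$, the bound is of order $d\sqrt{T\log N}$: there is a constant $c$, depending only on $\lambda,R,C,\delta$, such that for all integers $T,d,K\ge1$ and $N\ge2$ the right-hand side satisfies $B\le c\,d\sqrt{T\log N}\,(\log(1+T))^{3/2}$. -/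

import Mathlib

open MeasureTheory ProbabilityTheory

/-- Laplacian `D - W` of a weighted graph with weight matrix `w`. -/
def graphLaplacian {V : Type*} [Fintype V] [DecidableEq V] (w : Matrix V V ℝ) : Matrix V V ℝ :=
  Matrix.diagonal (fun i => ∑ j, w i j) - w

/-- Data of a spectral bandit: the diagonal entries `eig` of `Λ_L` (nonnegative, the smallest one
being zero) and for every arm a feature vector of Euclidean norm at most one. -/
structure SpectralBandit (A ι : Type*) [Fintype ι] where
  eig : ι → ℝ
  feat : A → EuclideanSpace ℝ ι
  eig_nonneg : ∀ i, 0 ≤ eig i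
  exists_eig_eq_zero : ∃ i, eig i = 0
  norm_feat_le : ∀ a, ‖feat a‖ ≤ 1

theorem graphLaplacian_quadratic {V : Type*} [Fintype V] [DecidableEq V] (w : Matrix V V ℝ)
    (hsymm : w.IsSymm) (f : V → ℝ) :
    f ⬝ᵥ (graphLaplacian w).mulVec f = (1 / 2) * ∑ i, ∑ j, w i j * (f i - f j) ^ 2 := by
  have e1 : f ⬝ᵥ (graphLaplacian w).mulVec f
      = (∑ i, ∑ j, w i j * f i ^ 2) - ∑ i, ∑ j, w i j * (f i * f j) := by
    rw [graphLaplacian, Matrix.sub_mulVec, dotProduct_sub]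
    congr 1
    · simp only [dotProduct, Matrix.mulVec_diagonal, Finset.sum_mul, Finset.mul_sum]
      exact Finset.sum_congr rfl fun i _ => Finset.sum_congr rfl fun j _ => by ring
    · simp only [dotProduct, Matrix.mulVec, Finset.mul_sum]
      exact Finset.sum_congr rfl fun i _ => Finset.sum_congr rfl fun j _ => by ring
  have e2 : ∑ i, ∑ j, w i j * f j ^ 2 = ∑ i, ∑ j, w i j * f i ^ 2 := by
    rw [Finset.sum_comm]
    exact Finset.sum_congr rfl fun i _ => Finset.sum_congr rfl fun j _ => by rw [hsymm.apply]
  have e3 : ∑ i, ∑ j, w i j * (f i - f j) ^ 2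
      = (∑ i, ∑ j, w i j * f i ^ 2) + (∑ i, ∑ j, w i j * f j ^ 2)
        - 2 * ∑ i, ∑ j, w i j * (f i * f j) := by
    simp only [Finset.mul_sum, ← Finset.sum_add_distrib, ← Finset.sum_sub_distrib]
    exact Finset.sum_congr rfl fun i _ => Finset.sum_congr rfl fun j _ => by ring
  rw [e1, e3, e2]
  ring

/-- The spectral bandit of a weighted graph: for an eigendecomposition `L = Q Λ_L Qᵀ` of its
Laplacian with `Q` orthogonal, the arms are the nodes and the feature vector of a node `v` is
the `v`-th row of `Q`. -/
def SpectralBandit.ofGraph {V ι : Type*} [Fintype V] [DecidableEq V] [Nonempty V] [Fintype ι]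
    [DecidableEq ι] (w : Matrix V V ℝ) (hsymm : w.IsSymm) (hnonneg : ∀ i j, 0 ≤ w i j)
    (Q : Matrix V ι ℝ) (hQ : Q.transpose * Q = 1) (hQ' : Q * Q.transpose = 1) (μ : ι → ℝ)
    (hL : graphLaplacian w = Q * Matrix.diagonal μ * Q.transpose) : SpectralBandit V ι where
  eig := μ
  feat v := WithLp.toLp 2 (Q v)
  eig_nonneg i := by
    have h1 : Q.transpose i ⬝ᵥ (graphLaplacian w).mulVec (Q.transpose i) = μ i := by
      have h2 : Q.transpose * graphLaplacian w * Q = Matrix.diagonal μ := by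
        rw [hL, Matrix.mul_assoc Q, ← Matrix.mul_assoc Q.transpose, hQ, Matrix.one_mul,
          Matrix.mul_assoc, hQ, Matrix.mul_one]
      have h3 := congrFun (congrFun h2 i) i
      rw [Matrix.diagonal_apply_eq, Matrix.mul_assoc] at h3
      rw [← h3]
      rfl
    rw [← h1, graphLaplacian_quadratic w hsymm]
    exact mul_nonneg (by norm_num) (Finset.sum_nonneg fun i _ => Finset.sum_nonneg fun j _ =>
      mul_nonneg (hnonneg i j) (sq_nonneg _))
  exists_eig_eq_zero := by
    by_contra hne
    push Not at hne
    have h1 : (graphLaplacian w).mulVec 1 = 0 := by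
      ext i
      rw [graphLaplacian, Matrix.sub_mulVec]
      simp [Matrix.mulVec, dotProduct, Matrix.diagonal_apply]
    have h2 : (Matrix.diagonal μ).mulVec (Q.transpose.mulVec 1) = 0 := by
      have h3 : Q.transpose.mulVec ((graphLaplacian w).mulVec 1) = 0 := by rw [h1]; simp
      rwa [hL, Matrix.mul_assoc, ← Matrix.mulVec_mulVec, Matrix.mulVec_mulVec _ Q.transpose, hQ,
        Matrix.one_mulVec, ← Matrix.mulVec_mulVec] at h3
    have h4 : Q.transpose.mulVec 1 = 0 := by
      ext i
      have := congrFun h2 i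
      rw [Matrix.mulVec_diagonal] at this
      exact (mul_eq_zero.mp this).resolve_left (hne i)
    have h5 : (1 : V → ℝ) = 0 := by
      rw [← Matrix.one_mulVec (1 : V → ℝ), ← hQ', ← Matrix.mulVec_mulVec, h4, Matrix.mulVec_zero]
    exact one_ne_zero (congrFun h5 (Classical.arbitrary V))
  norm_feat_le v := by
    have h := congrFun (congrFun hQ' v) v
    rw [Matrix.one_apply_eq, Matrix.mul_apply] at h
    rw [EuclideanSpace.norm_eq]
    apply le_of_eq
    rw [Real.sqrt_eq_one, ← h]
    exact Finset.sum_congr rfl fun i _ => by simp [sq]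

namespace SpectralBandit

variable {A ι : Type*} [Fintype ι] (M : SpectralBandit A ι)

/-- Multiplicity `K` of the eigenvalue zero of `Λ_L`. -/
noncomputable def zeroMult : ℕ := Nat.card {i : ι // M.eig i = 0}

/-- The effective dimension: the ceiling of `max ∑ log (1 + tᵢ / λᵢ)` over all nonnegative `t`
of total mass `T`, divided by `log (1 + T / (K λ))`; here `λᵢ = eig i + lam`. -/
noncomputable def effDim (lam : ℝ) (T : ℕ) : ℕ :=
  ⌈sSup {y : ℝ | ∃ t : ι → ℝ, (∀ i, 0 ≤ t i) ∧ ∑ i, t i = T ∧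
      y = ∑ i, Real.log (1 + t i / (M.eig i + lam))}
    / Real.log (1 + T / (M.zeroMult * lam))⌉₊

/-- `‖α‖_Λ` for `Λ = Λ_L + lam I`. -/
noncomputable def lamNorm (lam : ℝ) (α : EuclideanSpace ℝ ι) : ℝ :=
  Real.sqrt (∑ i, (M.eig i + lam) * α i ^ 2)

/-- Mean reward `x_aᵀ α` of the arm `a`. -/
noncomputable def mean (α : EuclideanSpace ℝ ι) (a : A) : ℝ := inner ℝ (M.feat a) α

/-- `V = Λ + ∑ x_{a_s} x_{a_s}ᵀ` after the history `h` of (arm, reward) pairs. -/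
noncomputable def gram [DecidableEq ι] (lam : ℝ) {t : ℕ} (h : Fin t → A × ℝ) : Matrix ι ι ℝ :=
  Matrix.diagonal (fun i => M.eig i + lam) +
    ∑ s, Matrix.vecMulVec (M.feat (h s).1).ofLp (M.feat (h s).1).ofLp

/-- The estimate `V⁻¹ ∑ x_{a_s} r_s` after the history `h`. -/
noncomputable def estimate [DecidableEq ι] (lam : ℝ) {t : ℕ} (h : Fin t → A × ℝ) :
    EuclideanSpace ℝ ι :=
  WithLp.toLp 2 ((M.gram lam h)⁻¹.mulVec (∑ s, (h s).2 • (M.feat (h s).1).ofLp))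

/-- The history of (arm, reward) pairs of the rounds before round `t`, where the reward is
`x_aᵀ α + ε`. Rounds are numbered from `0`. -/
noncomputable def history {Ω : Type*} (α : EuclideanSpace ℝ ι) (a : ℕ → Ω → A) (ε : ℕ → Ω → ℝ)
    (t : ℕ) (ω : Ω) : Fin t → A × ℝ :=
  fun s => (a s ω, M.mean α (a s ω) + ε s ω)

/-- `T max_v x_vᵀ α - ∑_{t < T} x_{a_t}ᵀ α`. -/
noncomputable def regret [Fintype A] [Nonempty A] {Ω : Type*} (α : EuclideanSpace ℝ ι)
    (a : ℕ → Ω → A) (T : ℕ) (ω : Ω) : ℝ :=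
  T * Finset.univ.sup' Finset.univ_nonempty (M.mean α) - ∑ t ∈ Finset.range T, M.mean α (a t ω)

/-- The covariance matrix used below is positive semidefinite, so that Mathlib's
`multivariateGaussian` is the genuine Gaussian measure. -/
theorem posSemidef_cov [DecidableEq ι] {lam : ℝ} (hlam : 0 < lam) (v : ℝ) {t : ℕ}
    (h : Fin t → A × ℝ) : (v ^ 2 • (M.gram lam h)⁻¹).PosSemidef := by
  have h1 : (M.gram lam h).PosDef := by
    refine Matrix.PosDef.add_posSemidef (Matrix.PosDef.diagonal fun i => ?_) ?_
    · linarith [M.eig_nonneg i]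
    · refine Matrix.posSemidef_sum _ fun s _ => ?_
      simpa using Matrix.posSemidef_vecMulVec_self_star (M.feat (h s).1).ofLp
  exact h1.inv.posSemidef.smul (sq_nonneg v)

end SpectralBandit

/-- The scale `v = R √(3 d log (1/δ + T/(δ λ K))) + C` of the sampling distribution. -/
noncomputable def tsScale (lam R C δ : ℝ) (T d K : ℕ) : ℝ :=
  R * Real.sqrt (3 * d * Real.log (1 / δ + T / (δ * lam * K))) + C

/-- The constant `g` of the regret bound, for `N` arms. -/
noncomputable def tsG (lam R C δ : ℝ) (T d K N : ℕ) : ℝ :=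
  Real.sqrt (4 * Real.log (T * N)) *
      (R * Real.sqrt (3 * d * Real.log (1 / δ + T / (δ * lam * K))) + C) +
    R * Real.sqrt (d * Real.log (T ^ 2 / δ + T ^ 3 / (δ * lam * K))) + C

/-- The constant `p = 1 / (4 e √π)`. -/
noncomputable def tsP : ℝ := 1 / (4 * Real.exp 1 * Real.sqrt Real.pi)

/-- The regret bound. -/
noncomputable def tsBound (lam R C δ : ℝ) (T d K N : ℕ) : ℝ :=
  11 * tsG lam R C δ T d K N / tsP *
      Real.sqrt ((2 + 2 * lam) / lam * d * T * Real.log (1 + T / (K * lam))) +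
    1 / T +
    tsG lam R C δ T d K N / tsP * (11 / Real.sqrt lam + 2) *
      Real.sqrt (2 * T * Real.log (2 / δ))

/-- A run of SpectralTS for `T` rounds on the bandit `M` with unknown parameter `α`. In round `t`,
given the observed history, the sample `αs t` has law `N(α̂_t, v² V_t⁻¹)`; the arm `a t` maximizes
`x_aᵀ (αs t)` (ties broken in any way); given the history and the played arm, the noise `ε t` is
centred and `R`-sub-Gaussian. -/
structure IsSpectralTSRun {A ι Ω : Type*} [Fintype ι] [DecidableEq ι] [MeasurableSpace A]
    [MeasurableSpace Ω] (M : SpectralBandit A ι) (lam R v : ℝ) (α : EuclideanSpace ℝ ι) (T : ℕ)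
    (P : Measure Ω) [IsProbabilityMeasure P] (αs : ℕ → Ω → EuclideanSpace ℝ ι) (a : ℕ → Ω → A)
    (ε : ℕ → Ω → ℝ) : Prop where
  measurable_sample : ∀ t < T, Measurable (αs t)
  measurable_arm : ∀ t < T, Measurable (a t)
  measurable_noise : ∀ t < T, Measurable (ε t)
  sample_law : ∀ t < T, ∀ᵐ ω ∂P,
    condDistrib (αs t) (M.history α a ε t) P (M.history α a ε t ω) =
      multivariateGaussian (M.estimate lam (M.history α a ε t ω))
        (v ^ 2 • (M.gram lam (M.history α a ε t ω))⁻¹)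
  arm_argmax : ∀ t < T, ∀ ω b, inner ℝ (M.feat b) (αs t ω) ≤ inner ℝ (M.feat (a t ω)) (αs t ω)
  noise_integrable : ∀ t < T, Integrable (ε t) P
  noise_centred : ∀ t < T,
    P[ε t | MeasurableSpace.comap (fun ω => (M.history α a ε t ω, a t ω)) inferInstance] =ᵐ[P] 0
  noise_exp_integrable : ∀ t < T, ∀ s : ℝ, Integrable (fun ω => Real.exp (s * ε t ω)) P
  noise_subgaussian : ∀ t < T, ∀ s : ℝ,
    P[fun ω => Real.exp (s * ε t ω) |
        MeasurableSpace.comap (fun ω => (M.history α a ε t ω, a t ω)) inferInstance]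
      ≤ᵐ[P] fun _ => Real.exp (R ^ 2 * s ^ 2 / 2)

/-! ### Positive definite matrices: rank-one updates, Hadamard's inequality, bounds in the inverse
norm. -/

section LinearAlgebra

variable {n : Type*} [Fintype n]

/-! The regret of a round is charged to the width `‖x‖_{V⁻¹}` of the arm played in it, because
squared widths are controlled by a determinant. Each round multiplies det V by 1 + width² (matrix
determinant lemma), while Hadamard's inequality bounds log (det V / det Λ) by the maximum that
defines the effective dimension. With Cauchy–Schwarz, the widths add up to at most a multiple of
√(dTL), where L = log (1 + T/(Kλ)) (`sum_width_le`).

The estimates are accurate. Let S be the sum of the noise vectors. Then exp (‖S‖²_{V⁻¹} / (2ρ²)) /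
√(det V / det Λ) is a nonnegative supermartingale: its one-step factor is a Gaussian mixture of
exponentials of the noise. Ville's inequality handles all rounds at once, so outside a small event
every estimated mean is within β widths of the true one (`measure_exists_noiseNormSq_gt_le`), and
the parameters give β ≤ 3v/2.

The sampling is good enough (`integral_mul_regret_sub_width_le`). The best mean is compared with
`maxLower`, a benchmark fixed by the history. If the sample is concentrated, the sampled reward of
the played arm is at least the benchmark, so the regret is at most the gap (best mean minus
benchmark) plus γv + β widths. The gap is paid for by optimism: with conditional probability at
least r the sample is concentrated and also overestimates the best arm, and then the gap is at most
2γv widths of the played arm. Since the history fixes the gap, it is at most 2γv/r times the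
conditional mean width.

Hence regret minus a multiple of the width minus a tiny constant is a bounded supermartingale
difference, and Azuma–Hoeffding gives the remaining term. The numerical constants need a long
horizon; if T is not large compared with (1 + λ)dL, or if C = 0, the trivial bound 2CT/√λ already
suffices. -/

theorem Matrix.PosSemidef.sq_dotProduct_mulVec_le {M : Matrix n n ℝ} (hM : M.PosSemidef)
    (x y : n → ℝ) : (x ⬝ᵥ M.mulVec y) ^ 2 ≤ (x ⬝ᵥ M.mulVec x) * (y ⬝ᵥ M.mulVec y) := by
  have hsymm : y ⬝ᵥ M.mulVec x = x ⬝ᵥ M.mulVec y := by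
    have h := hM.isHermitian.eq
    rw [Matrix.conjTranspose_eq_transpose_of_trivial] at h
    rw [Matrix.dotProduct_mulVec, ← Matrix.mulVec_transpose, h, dotProduct_comm]
  have h (t : ℝ) : 0 ≤ (y ⬝ᵥ M.mulVec y) * (t * t) + (2 * (x ⬝ᵥ M.mulVec y)) * t
      + x ⬝ᵥ M.mulVec x := by
    have h1 := hM.dotProduct_mulVec_nonneg (x + t • y)
    simp only [star_trivial, Matrix.mulVec_add, Matrix.mulVec_smul, dotProduct_add,
      add_dotProduct, smul_dotProduct, dotProduct_smul, smul_eq_mul, hsymm] at h1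
    linarith
  have := discrim_le_zero h
  rw [discrim] at this
  linarith

theorem Matrix.PosDef.add_vecMulVec_self {V : Matrix n n ℝ} (hV : V.PosDef) (x : n → ℝ) :
    (V + Matrix.vecMulVec x x).PosDef :=
  hV.add_posSemidef (by simpa using Matrix.posSemidef_vecMulVec_self_star x)

variable [DecidableEq n]

theorem Matrix.PosDef.inv_dotProduct_nonneg {V : Matrix n n ℝ} (hV : V.PosDef) (x : n → ℝ) :
    0 ≤ x ⬝ᵥ V⁻¹.mulVec x := by
  simpa using hV.inv.posSemidef.dotProduct_mulVec_nonneg x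

theorem Matrix.PosDef.mulVec_inv_mulVec {V : Matrix n n ℝ} (hV : V.PosDef) (x : n → ℝ) :
    V.mulVec (V⁻¹.mulVec x) = x := by
  rw [Matrix.mulVec_mulVec, Matrix.mul_nonsing_inv _ hV.det_pos.ne'.isUnit, Matrix.one_mulVec]

theorem Matrix.PosDef.inv_mulVec_mulVec {V : Matrix n n ℝ} (hV : V.PosDef) (x : n → ℝ) :
    V⁻¹.mulVec (V.mulVec x) = x := by
  rw [Matrix.mulVec_mulVec, Matrix.nonsing_inv_mul _ hV.det_pos.ne'.isUnit, Matrix.one_mulVec]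

theorem Matrix.PosDef.dotProduct_inv_comm {V : Matrix n n ℝ} (hV : V.PosDef) (x y : n → ℝ) :
    y ⬝ᵥ V⁻¹.mulVec x = x ⬝ᵥ V⁻¹.mulVec y := by
  have h := hV.inv.isHermitian.eq
  rw [Matrix.conjTranspose_eq_transpose_of_trivial] at h
  rw [Matrix.dotProduct_mulVec, ← Matrix.mulVec_transpose, h, dotProduct_comm]

/-- The matrix determinant lemma; it makes the log-determinants along a run telescope. -/
theorem Matrix.PosDef.det_add_vecMulVec_self {V : Matrix n n ℝ} (hV : V.PosDef) (x : n → ℝ) :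
    (V + Matrix.vecMulVec x x).det = V.det * (1 + x ⬝ᵥ V⁻¹.mulVec x) := by
  rw [Matrix.vecMulVec_eq Unit, Matrix.det_add_replicateCol_mul_replicateRow
    hV.det_pos.ne'.isUnit]
  congr 1
  rw [Matrix.det_unique]
  simp [Matrix.mul_apply, Matrix.mulVec, dotProduct, Finset.sum_mul, Finset.mul_sum, mul_assoc]
  exact Finset.sum_comm

/-- Sherman–Morrison for the quadratic form. Here x is the played feature, e its noise and S the
past noise sum, so the increment is an explicit quadratic polynomial in the new noise. -/
theorem Matrix.PosDef.inv_add_vecMulVec_quadratic {V : Matrix n n ℝ} (hV : V.PosDef)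
    (x S : n → ℝ) (e : ℝ) :
    (S + e • x) ⬝ᵥ (V + Matrix.vecMulVec x x)⁻¹.mulVec (S + e • x) =
      S ⬝ᵥ V⁻¹.mulVec S +
        ((x ⬝ᵥ V⁻¹.mulVec x) * e ^ 2 + 2 * (x ⬝ᵥ V⁻¹.mulVec S) * e - (x ⬝ᵥ V⁻¹.mulVec S) ^ 2) /
          (1 + x ⬝ᵥ V⁻¹.mulVec x) := by
  have ha := hV.inv_dotProduct_nonneg x
  have hsymm : S ⬝ᵥ V⁻¹.mulVec x = x ⬝ᵥ V⁻¹.mulVec S := hV.dotProduct_inv_comm x S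
  set a := x ⬝ᵥ V⁻¹.mulVec x with haa
  set m := x ⬝ᵥ V⁻¹.mulVec S with hm
  have ha1 : 1 + a ≠ 0 := by positivity
  set w := S + e • x with hw
  -- The Sherman–Morrison candidate for the updated inverse applied to w; it is then verified by
  -- multiplying back.
  set y := V⁻¹.mulVec w - ((m + e * a) / (1 + a)) • V⁻¹.mulVec x with hy
  have hxw : x ⬝ᵥ V⁻¹.mulVec w = m + e * a := by
    simp [hw, Matrix.mulVec_add, Matrix.mulVec_smul, ← haa, ← hm]
  have h1 : (V + Matrix.vecMulVec x x).mulVec y = w := by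
    rw [Matrix.add_mulVec, hy, Matrix.mulVec_sub, Matrix.mulVec_smul, hV.mulVec_inv_mulVec,
      hV.mulVec_inv_mulVec, Matrix.mulVec_sub, Matrix.mulVec_smul, Matrix.vecMulVec_mulVec,
      Matrix.vecMulVec_mulVec, hxw, ← haa]
    ext i
    simp
    field_simp
    ring
  rw [← h1, (hV.add_vecMulVec_self x).inv_mulVec_mulVec, h1, hy]
  simp only [hw, Matrix.mulVec_add, Matrix.mulVec_smul, dotProduct_sub, dotProduct_add,
      add_dotProduct, smul_dotProduct, dotProduct_smul, smul_eq_mul, hsymm, ← haa, ← hm]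
  field_simp
  ring

/-- Hadamard's inequality for a matrix with unit diagonal. -/
theorem Matrix.PosDef.det_le_one_of_diag {V : Matrix n n ℝ} (hV : V.PosDef)
    (hd : ∀ i, V i i = 1) : V.det ≤ 1 := by
  have h1 : V.det = ∏ i, hV.isHermitian.eigenvalues i := by
    simpa using hV.isHermitian.det_eq_prod_eigenvalues
  have h2 : ∑ i, hV.isHermitian.eigenvalues i = Fintype.card n := by
    have := hV.isHermitian.trace_eq_sum_eigenvalues
    simp only [Matrix.trace, Matrix.diag, hd] at this
    simpa using this.symm
  -- The bound log μ ≤ μ - 1, summed over the eigenvalues, is zero because the trace equals the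
  -- dimension.
  have h3 : Real.log V.det ≤ 0 := by
    rw [h1, Real.log_prod (fun i _ => (hV.eigenvalues_pos i).ne')]
    calc ∑ i, Real.log (hV.isHermitian.eigenvalues i)
        ≤ ∑ i, (hV.isHermitian.eigenvalues i - 1) :=
          Finset.sum_le_sum fun i _ => Real.log_le_sub_one_of_pos (hV.eigenvalues_pos i)
      _ = 0 := by simp [h2]
  exact (Real.log_nonpos_iff hV.det_pos.le).mp h3

/-- Hadamard's inequality. -/
theorem Matrix.PosDef.det_le_prod_diag {V : Matrix n n ℝ} (hV : V.PosDef) :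
    V.det ≤ ∏ i, V i i := by
  have hpos : ∀ i, 0 < V i i := fun i => hV.diag_pos
  -- Conjugation by this matrix normalizes the diagonal to one.
  set D : Matrix n n ℝ := Matrix.diagonal fun i => (Real.sqrt (V i i))⁻¹ with hD
  have hDdet : D.det = ∏ i, (Real.sqrt (V i i))⁻¹ := Matrix.det_diagonal
  have hDunit : IsUnit D := by
    rw [Matrix.isUnit_iff_isUnit_det, hDdet]
    refine (Finset.prod_ne_zero_iff.mpr fun i _ => ?_).isUnit
    exact inv_ne_zero (Real.sqrt_pos.mpr (hpos i)).ne'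
  have hDs : star D = D := by
    rw [Matrix.star_eq_conjTranspose, hD, Matrix.diagonal_conjTranspose]
    simp
  have hW : (D * V * D).PosDef := by
    have := hV.mul_mul_conjTranspose_same (B := D) (by
      rw [Matrix.vecMul_injective_iff_isUnit]; exact hDunit)
    rwa [← Matrix.star_eq_conjTranspose, hDs] at this
  have h1 := hW.det_le_one_of_diag fun i => by
    rw [hD, Matrix.mul_diagonal, Matrix.diagonal_mul]
    have := Real.mul_self_sqrt (hpos i).le
    have h' := (Real.sqrt_pos.mpr (hpos i)).ne'
    field_simp
    linarith
  rw [Matrix.det_mul, Matrix.det_mul, hDdet] at h1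
  have h2 : (∏ i, (Real.sqrt (V i i))⁻¹) * (∏ i, (Real.sqrt (V i i))⁻¹) = (∏ i, V i i)⁻¹ := by
    rw [← Finset.prod_mul_distrib, ← Finset.prod_inv_distrib]
    refine Finset.prod_congr rfl fun i _ => ?_
    rw [← mul_inv, Real.mul_self_sqrt (hpos i).le]
  have h3 : V.det * (∏ i, V i i)⁻¹ ≤ 1 := by rw [← h2]; linarith
  rwa [← div_eq_mul_inv, div_le_one (Finset.prod_pos fun i _ => hpos i)] at h3

theorem Matrix.PosDef.inv_quadratic_le {V : Matrix n n ℝ} (hV : V.PosDef) {lam : ℝ}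
    (hlam : 0 < lam) (h : ∀ y : n → ℝ, lam * (y ⬝ᵥ y) ≤ y ⬝ᵥ V.mulVec y) (x : n → ℝ)
    (hx : x ⬝ᵥ x ≤ 1) : x ⬝ᵥ V⁻¹.mulVec x ≤ 1 / lam := by
  set y := V⁻¹.mulVec x with hy
  have h1 := h y
  rw [hy, hV.mulVec_inv_mulVec, ← hy, dotProduct_comm y x] at h1
  -- Expanding gives x·x - 2λ x·y + λ² y·y ≥ 0; with λ y·y ≤ x·y from `h1` this leaves λ x·y ≤ x·x ≤
  -- 1.
  have h2 : 0 ≤ (x - lam • y) ⬝ᵥ (x - lam • y) := by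
    simpa using dotProduct_star_self_nonneg (x - lam • y)
  simp only [dotProduct_sub, sub_dotProduct, smul_dotProduct, dotProduct_smul, smul_eq_mul,
    dotProduct_comm y x] at h2
  rw [le_div_iff₀ hlam]
  nlinarith

/-- If `Λ ≤ V`, the linear form `⟨x, V⁻¹ (S - Λ α)⟩` is controlled by the `V⁻¹`-norms of `x` and
`S` and the `Λ`-norm of `α`. -/
theorem Matrix.PosDef.abs_dotProduct_inv_sub_le {V Λ : Matrix n n ℝ} (hV : V.PosDef)
    (hΛ : Λ.PosSemidef) (h : ∀ y : n → ℝ, y ⬝ᵥ Λ.mulVec y ≤ y ⬝ᵥ V.mulVec y) (x S α : n → ℝ) :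
    |x ⬝ᵥ V⁻¹.mulVec (S - Λ.mulVec α)| ≤
      Real.sqrt (x ⬝ᵥ V⁻¹.mulVec x) *
        (Real.sqrt (S ⬝ᵥ V⁻¹.mulVec S) + Real.sqrt (α ⬝ᵥ Λ.mulVec α)) := by
  have hcs (u w : n → ℝ) : |u ⬝ᵥ V⁻¹.mulVec w| ≤
      Real.sqrt (u ⬝ᵥ V⁻¹.mulVec u) * Real.sqrt (w ⬝ᵥ V⁻¹.mulVec w) := by
    rw [← Real.sqrt_mul (hV.inv_dotProduct_nonneg u)]
    exact Real.abs_le_sqrt (hV.inv.posSemidef.sq_dotProduct_mulVec_le u w)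
  have h2 : Real.sqrt (Λ.mulVec α ⬝ᵥ V⁻¹.mulVec (Λ.mulVec α)) ≤
      Real.sqrt (α ⬝ᵥ Λ.mulVec α) := by
    apply Real.sqrt_le_sqrt
    set y := V⁻¹.mulVec (Λ.mulVec α) with hy
    have hVy : V.mulVec y = Λ.mulVec α := hV.mulVec_inv_mulVec _
    have e1 : Λ.mulVec α ⬝ᵥ y = y ⬝ᵥ Λ.mulVec α := dotProduct_comm _ _
    -- With q = y·Λα, Cauchy–Schwarz gives q² ≤ (y·Λy)(α·Λα), and y·Λy ≤ y·Vy = q. Dividing by q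
    -- yields q ≤ α·Λα.
    have e2 := hΛ.sq_dotProduct_mulVec_le y α
    have e3 := h y
    rw [hVy] at e3
    have e4 : 0 ≤ α ⬝ᵥ Λ.mulVec α := by simpa using hΛ.dotProduct_mulVec_nonneg α
    have e5 : 0 ≤ y ⬝ᵥ Λ.mulVec y := by simpa using hΛ.dotProduct_mulVec_nonneg y
    rw [e1]
    by_contra hlt
    push Not at hlt
    nlinarith
  rw [Matrix.mulVec_sub, dotProduct_sub, mul_add]
  calc _ ≤ |x ⬝ᵥ V⁻¹.mulVec S| + |x ⬝ᵥ V⁻¹.mulVec (Λ.mulVec α)| := abs_sub _ _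
    _ ≤ _ := add_le_add (hcs _ _) ((hcs _ _).trans
      (mul_le_mul_of_nonneg_left h2 (Real.sqrt_nonneg _)))

end LinearAlgebra

/-! ### Gaussian integrals, tails and one-dimensional projections. -/

section Gaussian

/-- Completing the square turns the integrand into a multiple of the density of the normal law with
mean B/(1+a) and variance 1/(1+a). -/
theorem lintegral_exp_quadratic_gaussianReal {a : ℝ} (ha : 0 ≤ a) (B : ℝ) :
    ∫⁻ z, ENNReal.ofReal (Real.exp (B * z - a * z ^ 2 / 2)) ∂gaussianReal 0 1 =
      ENNReal.ofReal (Real.exp (B ^ 2 / (2 * (1 + a))) / Real.sqrt (1 + a)) := by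
  have h1a : 0 < 1 + a := by positivity
  obtain ⟨w, hw⟩ : ∃ w : NNReal, (w : ℝ) = (1 + a)⁻¹ :=
    ⟨((1 + a)⁻¹).toNNReal, Real.coe_toNNReal _ (by positivity)⟩
  have hw0 : w ≠ 0 := by
    rintro rfl
    exact (inv_pos.mpr h1a).ne hw
  rw [gaussianReal_of_var_ne_zero _ one_ne_zero,
    lintegral_withDensity_eq_lintegral_mul _ (measurable_gaussianPDF _ _) (by fun_prop)]
  have key (z : ℝ) : (gaussianPDF 0 1 * fun z => ENNReal.ofReal (Real.exp (B * z - a * z ^ 2 / 2))) z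
      = ENNReal.ofReal (Real.exp (B ^ 2 / (2 * (1 + a))) / Real.sqrt (1 + a)) *
        ENNReal.ofReal (gaussianPDFReal (B / (1 + a)) w z) := by
    rw [Pi.mul_apply, gaussianPDF, ← ENNReal.ofReal_mul (gaussianPDFReal_nonneg _ _ _),
      ← ENNReal.ofReal_mul (by positivity)]
    congr 1
    simp only [gaussianPDFReal, NNReal.coe_one, hw, mul_one, sub_zero]
    have e1 : Real.sqrt (2 * Real.pi * (1 + a)⁻¹) = Real.sqrt (2 * Real.pi) / Real.sqrt (1 + a) := by
      rw [← div_eq_mul_inv, Real.sqrt_div (by positivity)]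
    have e2 : Real.exp (-z ^ 2 / 2) * Real.exp (B * z - a * z ^ 2 / 2) =
        Real.exp (B ^ 2 / (2 * (1 + a))) *
          Real.exp (-(z - B / (1 + a)) ^ 2 / (2 * (1 + a)⁻¹)) := by
      rw [← Real.exp_add, ← Real.exp_add]
      congr 1
      field_simp
      ring
    rw [e1, mul_assoc, e2]
    have := (Real.sqrt_pos.mpr h1a).ne'
    field_simp
  simp_rw [key]
  rw [lintegral_const_mul _ (by fun_prop), lintegral_gaussianPDFReal_eq_one _ hw0, mul_one]

/-- The one-dimensional method of mixtures for a sub-Gaussian law `ν`. -/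
theorem lintegral_exp_mixture_le {ν : Measure ℝ} [SFinite ν] {R : ℝ} (hR : 0 < R)
    (hν : ∀ s : ℝ, ∫⁻ e, ENNReal.ofReal (Real.exp (s * e)) ∂ν ≤
      ENNReal.ofReal (Real.exp (R ^ 2 * s ^ 2 / 2)))
    {a : ℝ} (ha : 0 ≤ a) (m : ℝ) :
    ∫⁻ e, ENNReal.ofReal (Real.exp ((a * e ^ 2 + 2 * m * e - m ^ 2) / (2 * R ^ 2 * (1 + a)))) ∂ν ≤
      ENNReal.ofReal (Real.sqrt (1 + a)) := by
  have h1a : 0 < 1 + a := by positivity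
  have hs := Real.sqrt_pos.mpr h1a
  have hsa := Real.sq_sqrt ha
  -- The square of e is linearized: up to √(1+a), the exponential is the average over a Gaussian
  -- shift Z = m + √a R z of exp (Ze/R² - Z²/(2R²)), which is linear in e in the exponent.
  have key (e : ℝ) : ENNReal.ofReal
      (Real.exp ((a * e ^ 2 + 2 * m * e - m ^ 2) / (2 * R ^ 2 * (1 + a)))) =
      ENNReal.ofReal (Real.sqrt (1 + a)) * ∫⁻ z, ENNReal.ofReal (Real.exp
        (((m + Real.sqrt a * R * z) / R ^ 2) * e - (m + Real.sqrt a * R * z) ^ 2 / (2 * R ^ 2)))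
          ∂gaussianReal 0 1 := by
    have h1 (z : ℝ) : ENNReal.ofReal (Real.exp
        (((m + Real.sqrt a * R * z) / R ^ 2) * e - (m + Real.sqrt a * R * z) ^ 2 / (2 * R ^ 2)))
        = ENNReal.ofReal (Real.exp ((2 * m * e - m ^ 2) / (2 * R ^ 2))) *
          ENNReal.ofReal (Real.exp ((Real.sqrt a * (e - m) / R) * z - a * z ^ 2 / 2)) := by
      rw [← ENNReal.ofReal_mul (Real.exp_nonneg _), ← Real.exp_add]
      congr 2
      field_simp
      linear_combination (-(R ^ 2 * z ^ 2)) * hsa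
    simp_rw [h1]
    rw [lintegral_const_mul _ (by fun_prop), lintegral_exp_quadratic_gaussianReal ha,
      ← ENNReal.ofReal_mul (Real.exp_nonneg _), ← ENNReal.ofReal_mul hs.le, ← mul_div_assoc,
      ← Real.exp_add, mul_div_cancel₀ _ hs.ne']
    congr 2
    field_simp
    rw [hsa]
    ring
  simp_rw [key]
  rw [lintegral_const_mul _ (by
    refine Measurable.lintegral_prod_right' (f := fun p : ℝ × ℝ => ENNReal.ofReal (Real.exp
        (((m + Real.sqrt a * R * p.2) / R ^ 2) * p.1
          - (m + Real.sqrt a * R * p.2) ^ 2 / (2 * R ^ 2)))) ?_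
    fun_prop)]
  -- After Tonelli, the inner integral is the exponential moment at s = Z/R², whose bound exp
  -- (Z²/(2R²)) exactly cancels the compensator.
  rw [lintegral_lintegral_swap (by fun_prop)]
  conv_rhs => rw [← mul_one (ENNReal.ofReal _)]
  gcongr
  calc _ ≤ ∫⁻ _, 1 ∂gaussianReal 0 1 := by
        refine lintegral_mono fun z => ?_
        set Z := m + Real.sqrt a * R * z
        have h1 (e : ℝ) : ENNReal.ofReal (Real.exp (Z / R ^ 2 * e - Z ^ 2 / (2 * R ^ 2))) =
            ENNReal.ofReal (Real.exp (-(Z ^ 2 / (2 * R ^ 2)))) *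
              ENNReal.ofReal (Real.exp (Z / R ^ 2 * e)) := by
          rw [← ENNReal.ofReal_mul (Real.exp_nonneg _), ← Real.exp_add]
          congr 2
          ring
        simp_rw [h1]
        rw [lintegral_const_mul _ (by fun_prop)]
        refine (mul_le_mul_right (hν _) _).trans ?_
        rw [← ENNReal.ofReal_mul (Real.exp_nonneg _), ← Real.exp_add]
        refine le_of_eq ?_
        rw [ENNReal.ofReal_eq_one, Real.exp_eq_one_iff]
        field_simp
        ring
    _ = 1 := by simp

/-- On [3/2, 2], of length 1/2, the density is at least its value at 2. -/
theorem gaussianReal_ge_three_halves :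
    ENNReal.ofReal (Real.exp (-2) / Real.sqrt (2 * Real.pi) / 2) ≤
      gaussianReal 0 1 (Set.Ici (3 / 2)) := by
  rw [gaussianReal_apply _ one_ne_zero]
  calc _ = ∫⁻ _ in Set.Icc (3 / 2 : ℝ) 2,
        ENNReal.ofReal (Real.exp (-2) / Real.sqrt (2 * Real.pi)) := by
        rw [setLIntegral_const, Real.volume_Icc, ← ENNReal.ofReal_mul (by positivity)]
        congr 1
        ring
    _ ≤ ∫⁻ x in Set.Icc (3 / 2 : ℝ) 2, gaussianPDF 0 1 x := by
        refine setLIntegral_mono (measurable_gaussianPDF _ _) fun x hx => ?_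
        rw [gaussianPDF]
        refine ENNReal.ofReal_le_ofReal ?_
        simp only [gaussianPDFReal, NNReal.coe_one, mul_one, sub_zero]
        rw [div_eq_inv_mul]
        gcongr
        nlinarith [hx.1, hx.2]
    _ ≤ _ := lintegral_mono_set fun x hx => hx.1

theorem gaussianReal_abs_gt_le {γ : ℝ} (hγ : 0 ≤ γ) :
    gaussianReal 0 1 {z | γ < |z|} ≤ ENNReal.ofReal (2 * Real.exp (-γ ^ 2 / 2)) := by
  have hsub : HasSubgaussianMGF id 1 (gaussianReal 0 1) :=
    ⟨fun t => integrable_exp_mul_gaussianReal t, fun t => by simp [mgf_id_gaussianReal]⟩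
  have h1 := hsub.measure_ge_le hγ
  have h2 := hsub.neg.measure_ge_le hγ
  have h3 : {z : ℝ | γ < |z|} ⊆ {z | γ ≤ id z} ∪ {z | γ ≤ (-id) z} := by
    intro z hz
    rw [Set.mem_ofPred_eq] at hz
    rcases lt_abs.mp hz with h | h
    · exact Or.inl h.le
    · exact Or.inr h.le
  refine (measure_mono h3).trans ((measure_union_le _ _).trans ?_)
  rw [two_mul, ENNReal.ofReal_add (Real.exp_nonneg _) (Real.exp_nonneg _)]
  simp only [NNReal.coe_one, mul_one] at h1 h2
  refine add_le_add ?_ ?_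
  · rw [← ofReal_measureReal]; exact ENNReal.ofReal_le_ofReal h1
  · rw [← ofReal_measureReal]; exact ENNReal.ofReal_le_ofReal h2

/-- Phrased with the standard deviation σ, so that the degenerate case σ = 0 needs no separate
treatment. -/
theorem gaussianReal_eq_map_standard (m σ : ℝ) :
    gaussianReal m (NNReal.mk (σ ^ 2) (sq_nonneg σ)) = (gaussianReal 0 1).map fun z => m + σ * z := by
  have h1 := gaussianReal_map_const_mul (μ := 0) (v := 1) σ
  have h2 := gaussianReal_map_const_add (μ := σ * 0) (v := NNReal.mk (σ ^ 2) (sq_nonneg σ) * 1) m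
  rw [← h1, Measure.map_map (by fun_prop) (by fun_prop)] at h2
  simp only [mul_zero, mul_one, zero_add] at h2
  rw [← h2]
  rfl

variable {ι : Type*} [Fintype ι] [DecidableEq ι]

theorem multivariateGaussian_map_inner (μ x : EuclideanSpace ℝ ι) {S : Matrix ι ι ℝ}
    (hS : S.PosSemidef) :
    (multivariateGaussian μ S).map (fun θ => inner ℝ x θ) =
      (gaussianReal 0 1).map fun z =>
        inner ℝ x μ + Real.sqrt (x.ofLp ⬝ᵥ S.mulVec x.ofLp) * z := by
  have h0 : 0 ≤ x.ofLp ⬝ᵥ S.mulVec x.ofLp := by simpa using hS.dotProduct_mulVec_nonneg x.ofLp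
  have h1 := IsGaussian.map_eq_gaussianReal (μ := multivariateGaussian μ S) (innerSL ℝ x)
  have h2 : Var[innerSL ℝ x; multivariateGaussian μ S] = x.ofLp ⬝ᵥ S.mulVec x.ofLp := by
    rw [← covarianceBilin_multivariateGaussian (μ := μ) hS,
      covarianceBilin_self (IsGaussian.memLp_two_id)]
    rfl
  have h3 : (multivariateGaussian μ S)[innerSL ℝ x] = inner ℝ x μ := by
    have := ContinuousLinearMap.integral_comp_comm (innerSL ℝ x)
      (IsGaussian.integrable_id (μ := multivariateGaussian μ S))
    simp only [id] at this
    rw [this, integral_id_multivariateGaussian]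
    rfl
  rw [h2, h3] at h1
  rw [← gaussianReal_eq_map_standard]
  have h4 : (⇑(innerSL ℝ x) : EuclideanSpace ℝ ι → ℝ) = fun θ => inner ℝ x θ := rfl
  rw [h4] at h1
  rw [h1]
  congr 1
  refine NNReal.coe_injective ?_
  rw [Real.coe_toNNReal _ h0]
  exact (Real.sq_sqrt h0).symm

theorem multivariateGaussian_anticoncentration (μ x : EuclideanSpace ℝ ι) {S : Matrix ι ι ℝ}
    (hS : S.PosSemidef) {J : ℝ}
    (hJ : J ≤ inner ℝ x μ + Real.sqrt (x.ofLp ⬝ᵥ S.mulVec x.ofLp) * (3 / 2)) :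
    ENNReal.ofReal (Real.exp (-2) / Real.sqrt (2 * Real.pi) / 2) ≤
      multivariateGaussian μ S {θ | J ≤ inner ℝ x θ} := by
  have h1 : multivariateGaussian μ S {θ | J ≤ inner ℝ x θ} =
      (multivariateGaussian μ S).map (fun θ => inner ℝ x θ) (Set.Ici J) := by
    rw [Measure.map_apply (by fun_prop) measurableSet_Ici]
    rfl
  rw [h1, multivariateGaussian_map_inner μ x hS, Measure.map_apply (by fun_prop) measurableSet_Ici]
  refine gaussianReal_ge_three_halves.trans (measure_mono fun z hz => ?_)
  have hz' : (3 / 2 : ℝ) ≤ z := hz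
  have := mul_le_mul_of_nonneg_left hz' (Real.sqrt_nonneg (x.ofLp ⬝ᵥ S.mulVec x.ofLp))
  simp only [Set.mem_preimage, Set.mem_Ici]
  linarith

theorem multivariateGaussian_concentration (μ x : EuclideanSpace ℝ ι) {S : Matrix ι ι ℝ}
    (hS : S.PosSemidef) {γ : ℝ} (hγ : 0 ≤ γ) :
    multivariateGaussian μ S
        {θ | γ * Real.sqrt (x.ofLp ⬝ᵥ S.mulVec x.ofLp) < |inner ℝ x θ - inner ℝ x μ|} ≤
      ENNReal.ofReal (2 * Real.exp (-γ ^ 2 / 2)) := by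
  set σ := Real.sqrt (x.ofLp ⬝ᵥ S.mulVec x.ofLp) with hσ
  have hm : MeasurableSet {y : ℝ | γ * σ < |y - inner ℝ x μ|} :=
    measurableSet_lt (by fun_prop) (by fun_prop)
  have h1 : multivariateGaussian μ S {θ | γ * σ < |inner ℝ x θ - inner ℝ x μ|} =
      (multivariateGaussian μ S).map (fun θ => inner ℝ x θ)
        {y : ℝ | γ * σ < |y - inner ℝ x μ|} := by
    rw [Measure.map_apply (by fun_prop) hm]
    rfl
  rw [h1, multivariateGaussian_map_inner μ x hS, Measure.map_apply (by fun_prop) hm]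
  refine (measure_mono fun z hz => ?_).trans (gaussianReal_abs_gt_le hγ)
  have hσ0 : 0 ≤ σ := Real.sqrt_nonneg _
  simp only [Set.mem_preimage, Set.mem_ofPred_eq, add_sub_cancel_left, ← hσ, abs_mul,
    abs_of_nonneg hσ0] at hz ⊢
  rw [mul_comm] at hz
  exact lt_of_mul_lt_mul_left hz hσ0

end Gaussian

/-! ### Maximal inequalities and conditional laws. -/

section Probability

open scoped ENNReal

/-- Ville's maximal inequality for a nonnegative supermartingale up to a finite horizon. -/
theorem mul_measure_exists_le_of_supermartingale {Ω : Type*} [mΩ : MeasurableSpace Ω]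
    (P : Measure Ω) {T : ℕ} {Y : ℕ → Ω → ℝ≥0∞} {ℱ : ℕ → MeasurableSpace Ω}
    (hle : ∀ n ≤ T, ℱ n ≤ mΩ) (hmono : ∀ n ≤ T, ∀ k ≤ n, ℱ k ≤ ℱ n)
    (hY : ∀ n ≤ T, Measurable[ℱ n] (Y n)) (h0 : ∫⁻ ω, Y 0 ω ∂P ≤ 1)
    (hstep : ∀ n < T, ∀ B, MeasurableSet[ℱ n] B →
      ∫⁻ ω in B, Y (n + 1) ω ∂P ≤ ∫⁻ ω in B, Y n ω ∂P) (c : ℝ≥0∞) :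
    c * P {ω | ∃ n ≤ T, c ≤ Y n ω} ≤ 1 := by
  -- A n is the event that level c was reached strictly before time n; hence A 0 is empty and A (n +
  -- 1) is known at time n.
  set A : ℕ → Set Ω := fun n => {ω | ∃ k < n, c ≤ Y k ω} with hA
  have hset (n : ℕ) (hn : n ≤ T) : MeasurableSet[ℱ n] {ω | c ≤ Y n ω} :=
    hY n hn measurableSet_Ici
  have hAsucc (n : ℕ) : A (n + 1) = A n ∪ {ω | c ≤ Y n ω} := by
    ext ω
    simp only [hA, Set.mem_union, Set.mem_ofPred_eq, Nat.lt_succ_iff_lt_or_eq, or_and_right,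
      exists_or, exists_eq_left]
  have hAmeas (n : ℕ) (hn : n ≤ T) : MeasurableSet[ℱ n] (A (n + 1)) := by
    have : A (n + 1) = ⋃ k ∈ Set.Iio (n + 1), {ω | c ≤ Y k ω} := by
      ext ω; simp [hA]
    rw [this]
    refine MeasurableSet.biUnion (Set.to_countable _) fun k hk => ?_
    have hk' : k ≤ n := Nat.lt_succ_iff.mp hk
    exact hmono n hn k hk' _ (hset k (hk'.trans hn))
  -- The quantity c · P(already crossed) + E[Y; not yet crossed] does not increase when the
  -- crossings at time n are moved to the first term, since there Y n ≥ c.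
  have hone (n : ℕ) (hn : n ≤ T) : c * P (A (n + 1)) + ∫⁻ ω in (A (n + 1))ᶜ, Y n ω ∂P ≤
      c * P (A n) + ∫⁻ ω in (A n)ᶜ, Y n ω ∂P := by
    have hm : MeasurableSet {ω | c ≤ Y n ω} := hle n hn _ (hset n hn)
    have e1 : P (A (n + 1)) ≤ P (A n) + P ((A n)ᶜ ∩ {ω | c ≤ Y n ω}) := by
      refine (measure_mono fun ω hω => ?_).trans (measure_union_le _ _)
      rw [hAsucc] at hω
      by_cases h : ω ∈ A n
      · exact Or.inl h
      · exact Or.inr ⟨h, hω.resolve_left h⟩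
    have e2 : c * P ((A n)ᶜ ∩ {ω | c ≤ Y n ω}) ≤
        ∫⁻ ω in (A n)ᶜ ∩ {ω | c ≤ Y n ω}, Y n ω ∂P := by
      rw [← setLIntegral_const]
      refine setLIntegral_mono ((hY n hn).mono (hle n hn) le_rfl) fun ω hω => hω.2
    have e3 : (A (n + 1))ᶜ = (A n)ᶜ \ {ω | c ≤ Y n ω} := by
      rw [hAsucc, Set.compl_union, Set.sdiff_eq]
    rw [e3, ← lintegral_inter_add_sdiff (μ := P) (Y n) (A n)ᶜ hm, ← add_assoc]
    refine add_le_add_left ((mul_le_mul_right e1 c).trans ?_) _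
    rw [mul_add]
    exact add_le_add_right e2 _
  have hind (n : ℕ) (hn : n ≤ T) : c * P (A n) + ∫⁻ ω in (A n)ᶜ, Y n ω ∂P ≤ 1 := by
    induction n with
    | zero => simpa [hA] using h0
    | succ n ih =>
      have hn' : n < T := hn
      refine le_trans ?_ ((hone n hn'.le).trans (ih hn'.le))
      exact add_le_add_right (hstep n hn' _ (hAmeas n hn'.le).compl) _
  have hfin : {ω | ∃ n ≤ T, c ≤ Y n ω} = A (T + 1) := by
    ext ω
    simp [hA]
  rw [hfin]
  exact le_self_add.trans ((hone T le_rfl).trans (hind T le_rfl))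

/-- The convex exponential lies below its chord over [-b, b]. The term linear in w has a nonnegative
coefficient for η ≥ 0, so a supermartingale difference makes its mean nonpositive. -/
theorem Real.exp_mul_le_cosh_add {b w η : ℝ} (hb : 0 < b) (hw : |w| ≤ b) :
    Real.exp (η * w) ≤ Real.cosh (η * b) + w / b * Real.sinh (η * b) := by
  obtain ⟨h1, h2⟩ := abs_le.mp hw
  have ha1 : 0 ≤ (b + w) / (2 * b) := div_nonneg (by linarith) (by linarith)
  have ha2 : 0 ≤ (b - w) / (2 * b) := div_nonneg (by linarith) (by linarith)
  have := convexOn_exp.2 (Set.mem_univ (η * b)) (Set.mem_univ (-(η * b))) ha1 ha2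
    (by field_simp; ring)
  simp only [smul_eq_mul] at this
  have e1 : (b + w) / (2 * b) * (η * b) + (b - w) / (2 * b) * -(η * b) = η * w := by
    field_simp
    ring
  rw [e1] at this
  refine this.trans (le_of_eq ?_)
  rw [Real.cosh_eq, Real.sinh_eq]
  field_simp
  ring

/-- The Azuma–Hoeffding inequality for bounded supermartingale differences. -/
theorem measureReal_sum_ge_le_of_bounded {Ω : Type*} [mΩ : MeasurableSpace Ω]
    (P : Measure Ω) [IsProbabilityMeasure P] {T : ℕ} (hT : 1 ≤ T) {W : ℕ → Ω → ℝ}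
    {ℱ : ℕ → MeasurableSpace Ω}
    (hle : ∀ n ≤ T, ℱ n ≤ mΩ) (hmono : ∀ n < T, ℱ n ≤ ℱ (n + 1))
    (hW : ∀ n < T, Measurable[ℱ (n + 1)] (W n)) {b : ℝ} (hb : 0 < b)
    (hWb : ∀ n < T, ∀ ω, |W n ω| ≤ b)
    (hstep : ∀ n < T, ∀ ψ : Ω → ℝ, Measurable[ℱ n] ψ → (∀ ω, 0 ≤ ψ ω) →
      (∃ K, ∀ ω, ψ ω ≤ K) → ∫ ω, ψ ω * W n ω ∂P ≤ 0)
    {δ : ℝ} (hδ : 0 < δ) (hδ1 : δ < 1) :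
    P.real {ω | b * Real.sqrt (2 * T * Real.log (1 / δ)) ≤ ∑ n ∈ Finset.range T, W n ω} ≤ δ := by
  have hlog : 0 < Real.log (1 / δ) := Real.log_pos (by rw [lt_div_iff₀ hδ]; linarith)
  have hT0 : (0 : ℝ) < T := by exact_mod_cast hT
  have hSmeas (n : ℕ) (hn : n ≤ T) : Measurable[ℱ n] fun ω => ∑ i ∈ Finset.range n, W i ω := by
    induction n with
    | zero => simp
    | succ n ih =>
      simp only [Finset.sum_range_succ]
      exact ((ih (by omega)).mono (hmono n hn) le_rfl).add (hW n hn)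
  have hSb (n : ℕ) (hn : n ≤ T) (ω : Ω) : |∑ i ∈ Finset.range n, W i ω| ≤ n * b := by
    refine (Finset.abs_sum_le_sum_abs _ _).trans ?_
    calc _ ≤ ∑ _i ∈ Finset.range n, b := Finset.sum_le_sum fun i hi =>
            hWb i (by have := Finset.mem_range.mp hi; omega) ω
      _ = n * b := by simp
  have hbd (n : ℕ) (hn : n ≤ T) (η : ℝ) (ω : Ω) :
      Real.exp (η * ∑ i ∈ Finset.range n, W i ω) ≤ Real.exp (|η| * (n * b)) := by
    refine Real.exp_le_exp.mpr ((le_abs_self _).trans ?_)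
    rw [abs_mul]
    exact mul_le_mul_of_nonneg_left (hSb n hn ω) (abs_nonneg _)
  have hint (n : ℕ) (hn : n ≤ T) (η : ℝ) :
      Integrable (fun ω => Real.exp (η * ∑ i ∈ Finset.range n, W i ω)) P := by
    refine Integrable.of_bound (C := Real.exp (|η| * (n * b))) ?_ ?_
    · exact (((hSmeas n hn).mono (hle n hn) le_rfl).const_mul η).exp.aestronglyMeasurable
    · refine Filter.Eventually.of_forall fun ω => ?_
      rw [Real.norm_eq_abs, Real.abs_exp]
      exact hbd n hn η ω
  have hmgf (η : ℝ) (hη : 0 ≤ η) (n : ℕ) (hn : n ≤ T) :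
      ∫ ω, Real.exp (η * ∑ i ∈ Finset.range n, W i ω) ∂P ≤ Real.exp (n * ((η * b) ^ 2 / 2)) := by
    induction n with
    | zero => simp
    | succ n ih =>
      have hn' : n < T := hn
      set ψ : Ω → ℝ := fun ω => Real.exp (η * ∑ i ∈ Finset.range n, W i ω) with hψ
      have hψm : Measurable[ℱ n] ψ := Real.measurable_exp.comp ((hSmeas n hn'.le).const_mul η)
      have hψi : Integrable ψ P := hint n hn'.le η
      have hWm : Measurable (W n) := (hW n hn').mono (hle _ hn) le_rfl
      have hψW : Integrable (fun ω => ψ ω * W n ω) P := by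
        refine hψi.mul_bdd (c := b) hWm.aestronglyMeasurable ?_
        exact Filter.Eventually.of_forall fun ω => hWb n hn' ω
      have h1 := hstep n hn' ψ hψm (fun ω => Real.exp_nonneg _) ⟨_, hbd n hn'.le η⟩
      have hsinh : 0 ≤ Real.sinh (η * b) := Real.sinh_nonneg_iff.mpr (by positivity)
      calc _ ≤ ∫ ω, Real.cosh (η * b) * ψ ω + Real.sinh (η * b) / b * (ψ ω * W n ω) ∂P := by
            refine integral_mono (hint _ hn η) ((hψi.const_mul _).add (hψW.const_mul _))
              fun ω => ?_
            simp only [Finset.sum_range_succ, mul_add, Real.exp_add]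
            have h2 := mul_le_mul_of_nonneg_left
              (Real.exp_mul_le_cosh_add (η := η) hb (hWb n hn' ω)) (Real.exp_nonneg
                (η * ∑ i ∈ Finset.range n, W i ω))
            refine h2.trans (le_of_eq ?_)
            simp only [hψ]
            ring
        _ = Real.cosh (η * b) * ∫ ω, ψ ω ∂P
              + Real.sinh (η * b) / b * ∫ ω, ψ ω * W n ω ∂P := by
            rw [integral_add (hψi.const_mul _) (hψW.const_mul _), integral_const_mul,
              integral_const_mul]
        _ ≤ Real.cosh (η * b) * ∫ ω, ψ ω ∂P := by
            have := mul_nonpos_of_nonneg_of_nonpos (div_nonneg hsinh hb.le) h1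
            linarith
        _ ≤ Real.exp ((η * b) ^ 2 / 2) * Real.exp (n * ((η * b) ^ 2 / 2)) := by
            refine mul_le_mul (Real.cosh_le_exp_half_sq _) (ih hn'.le) ?_ (Real.exp_nonneg _)
            exact integral_nonneg fun ω => Real.exp_nonneg _
        _ = _ := by
            rw [← Real.exp_add]
            congr 1
            push_cast
            ring
  set r := Real.sqrt (2 * T * Real.log (1 / δ)) with hr
  have hr2 : r ^ 2 = 2 * T * Real.log (1 / δ) := Real.sq_sqrt (by positivity)
  -- The minimizer of -ηbr + T(ηb)²/2.
  set η := r / (T * b) with hη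
  have hη0 : 0 ≤ η := by positivity
  refine (measure_ge_le_exp_mul_mgf (X := fun ω => ∑ n ∈ Finset.range T, W n ω) (b * r) hη0
    (hint T le_rfl η)).trans ?_
  refine (mul_le_mul_of_nonneg_left (hmgf η hη0 T le_rfl) (Real.exp_nonneg _)).trans ?_
  rw [← Real.exp_add]
  have e : -η * (b * r) + T * ((η * b) ^ 2 / 2) = Real.log δ := by
    have e1 : η * b = r / T := by rw [hη]; field_simp
    have e2 : -η * (b * r) = -(r ^ 2 / T) := by rw [hη]; field_simp
    rw [e1, e2, div_pow, hr2, one_div, Real.log_inv]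
    field_simp
    ring
  rw [e, Real.exp_log hδ]

variable {Ω β γ : Type*} [MeasurableSpace Ω] [MeasurableSpace β] [MeasurableSpace γ]
  [StandardBorelSpace γ] [Nonempty γ]

theorem lintegral_eq_lintegral_condDistrib (P : Measure Ω) [IsFiniteMeasure P] {X : Ω → β}
    {Y : Ω → γ} (hX : Measurable X) (hY : Measurable Y) {F : β × γ → ℝ≥0∞} (hF : Measurable F) :
    ∫⁻ ω, F (X ω, Y ω) ∂P = ∫⁻ ω, ∫⁻ y, F (X ω, y) ∂condDistrib Y X P (X ω) ∂P := by
  have h1 := compProd_map_condDistrib (mβ := inferInstance) (X := X) (μ := P) hY.aemeasurable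
  rw [← lintegral_map hF (hX.prodMk hY), ← h1, Measure.lintegral_compProd hF,
    lintegral_map hF.lintegral_kernel_prod_right' hX]

/-- Conditional sub-Gaussianity gives sub-Gaussianity of almost every conditional law. -/
theorem ae_forall_lintegral_exp_condDistrib_le (P : Measure Ω) [IsProbabilityMeasure P]
    {X : Ω → β} {Y : Ω → ℝ} (hX : Measurable X) (hY : Measurable Y) {R : ℝ}
    (hint : ∀ s : ℝ, Integrable (fun ω => Real.exp (s * Y ω)) P)
    (hsub : ∀ s : ℝ, P[fun ω => Real.exp (s * Y ω) | MeasurableSpace.comap X inferInstance]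
      ≤ᵐ[P] fun _ => Real.exp (R ^ 2 * s ^ 2 / 2)) :
    ∀ᵐ ω ∂P, ∀ s : ℝ, ∫⁻ e, ENNReal.ofReal (Real.exp (s * e)) ∂condDistrib Y X P (X ω) ≤
      ENNReal.ofReal (Real.exp (R ^ 2 * s ^ 2 / 2)) := by
  have hX' := hX.aemeasurable (μ := P)
  have hker : Kernel.HasSubgaussianMGF (fun e : ℝ => e) (Real.toNNReal (R ^ 2))
      (condDistrib Y X P) (P.map X) := by
    -- The exceptional null set depends on the exponent s, so it is first removed for the countably
    -- many rational s and then extended to all real ones.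
    refine Kernel.HasSubgaussianMGF.of_rat ?_ ?_
    · intro t
      rw [condDistrib_comp_map hX' hY.aemeasurable,
        integrable_map_measure (by fun_prop) hY.aemeasurable]
      exact hint t
    · intro q
      have hm : MeasurableSet {x : β | mgf (fun e : ℝ => e) (condDistrib Y X P x) q ≤
          Real.exp (Real.toNNReal (R ^ 2) * (q : ℝ) ^ 2 / 2)} := by
        refine measurableSet_le ?_ measurable_const
        have hsm : StronglyMeasurable fun p : β × ℝ => Real.exp ((q : ℝ) * p.2) := by
          fun_prop
        exact hsm.integral_condDistrib.measurable
      rw [ae_map_iff hX' hm]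
      have h2 := condExp_ae_eq_integral_condDistrib hX hY.aemeasurable
        (f := fun e : ℝ => Real.exp ((q : ℝ) * e)) (by fun_prop) (hint q)
      filter_upwards [h2, hsub q] with ω h3 h4
      rw [h3] at h4
      rw [Real.coe_toNNReal _ (sq_nonneg R)]
      exact h4
  have h1 := ae_of_ae_map hX' hker.mgf_le
  have h2 := ae_of_ae_map hX' hker.ae_forall_integrable_exp_mul
  filter_upwards [h1, h2] with ω h3 h4 s
  rw [← ofReal_integral_eq_lintegral_ofReal (h4 s)
    (Filter.Eventually.of_forall fun _ => Real.exp_nonneg _)]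
  refine ENNReal.ofReal_le_ofReal ?_
  have := h3 s
  rwa [Real.coe_toNNReal _ (sq_nonneg R)] at this

end Probability

/-! ### Pathwise estimates: estimation error, determinants and effective dimension. -/

namespace SpectralBandit

section Deterministic

variable {A ι : Type*} [Fintype ι] [DecidableEq ι] (M : SpectralBandit A ι)

/-- The confidence width `‖x_b‖_{V⁻¹}` of the arm `b` after the history `h`. -/
noncomputable def width (lam : ℝ) {t : ℕ} (h : Fin t → A × ℝ) (b : A) : ℝ :=
  Real.sqrt ((M.feat b).ofLp ⬝ᵥ (M.gram lam h)⁻¹.mulVec (M.feat b).ofLp)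

/-- The sum `∑ ε_s x_{a_s}` of the noise vectors along the history `h`. -/
noncomputable def noiseSum (α : EuclideanSpace ℝ ι) {t : ℕ} (h : Fin t → A × ℝ) : ι → ℝ :=
  ∑ s, ((h s).2 - M.mean α (h s).1) • (M.feat (h s).1).ofLp

/-- The squared `V⁻¹`-norm of the noise sum. -/
noncomputable def noiseNormSq (lam : ℝ) (α : EuclideanSpace ℝ ι) {t : ℕ} (h : Fin t → A × ℝ) : ℝ :=
  M.noiseSum α h ⬝ᵥ (M.gram lam h)⁻¹.mulVec (M.noiseSum α h)

omit [DecidableEq ι] in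
theorem mean_eq_dotProduct (α : EuclideanSpace ℝ ι) (b : A) :
    M.mean α b = (M.feat b).ofLp ⬝ᵥ α.ofLp := by
  rw [mean, EuclideanSpace.inner_eq_star_dotProduct, star_trivial, dotProduct_comm]

omit [DecidableEq ι] in
theorem feat_dotProduct_self_le (b : A) : (M.feat b).ofLp ⬝ᵥ (M.feat b).ofLp ≤ 1 := by
  have h1 : (M.feat b).ofLp ⬝ᵥ (M.feat b).ofLp = ‖M.feat b‖ ^ 2 := by
    rw [← real_inner_self_eq_norm_sq, EuclideanSpace.inner_eq_star_dotProduct, star_trivial]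
  rw [h1]
  exact pow_le_one₀ (norm_nonneg _) (M.norm_feat_le b)

variable {lam : ℝ} (hlam : 0 < lam)

theorem lamNorm_eq (α : EuclideanSpace ℝ ι) :
    M.lamNorm lam α =
      Real.sqrt (α.ofLp ⬝ᵥ (Matrix.diagonal fun i => M.eig i + lam).mulVec α.ofLp) := by
  rw [lamNorm]
  congr 1
  simp only [dotProduct, Matrix.mulVec_diagonal]
  exact Finset.sum_congr rfl fun i _ => by ring

include hlam

theorem posDef_diagonal : (Matrix.diagonal fun i => M.eig i + lam).PosDef :=
  Matrix.PosDef.diagonal fun i => by linarith [M.eig_nonneg i]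

theorem posDef_gram {t : ℕ} (h : Fin t → A × ℝ) : (M.gram lam h).PosDef := by
  refine Matrix.PosDef.add_posSemidef (M.posDef_diagonal hlam) ?_
  refine Matrix.posSemidef_sum _ fun s _ => ?_
  simpa using Matrix.posSemidef_vecMulVec_self_star (M.feat (h s).1).ofLp

omit hlam in
theorem diagonal_le_gram {t : ℕ} (h : Fin t → A × ℝ) (y : ι → ℝ) :
    y ⬝ᵥ (Matrix.diagonal fun i => M.eig i + lam).mulVec y ≤ y ⬝ᵥ (M.gram lam h).mulVec y := by
  rw [gram, Matrix.add_mulVec, dotProduct_add]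
  have : (∑ s, Matrix.vecMulVec (M.feat (h s).1).ofLp (M.feat (h s).1).ofLp).PosSemidef := by
    refine Matrix.posSemidef_sum _ fun s _ => ?_
    simpa using Matrix.posSemidef_vecMulVec_self_star (M.feat (h s).1).ofLp
  have := this.dotProduct_mulVec_nonneg y
  simp only [star_trivial] at this
  linarith

omit hlam in
theorem mul_dotProduct_self_le_gram {t : ℕ} (h : Fin t → A × ℝ) (y : ι → ℝ) :
    lam * (y ⬝ᵥ y) ≤ y ⬝ᵥ (M.gram lam h).mulVec y := by
  refine le_trans ?_ (M.diagonal_le_gram h y)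
  simp only [dotProduct, Matrix.mulVec_diagonal, Finset.mul_sum]
  refine Finset.sum_le_sum fun i _ => ?_
  nlinarith [M.eig_nonneg i, mul_self_nonneg (y i)]

theorem width_sq {t : ℕ} (h : Fin t → A × ℝ) (b : A) :
    M.width lam h b ^ 2 = (M.feat b).ofLp ⬝ᵥ (M.gram lam h)⁻¹.mulVec (M.feat b).ofLp :=
  Real.sq_sqrt ((M.posDef_gram hlam h).inv_dotProduct_nonneg _)

omit hlam in
theorem width_nonneg {t : ℕ} (h : Fin t → A × ℝ) (b : A) : 0 ≤ M.width lam h b :=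
  Real.sqrt_nonneg _

theorem width_sq_le {t : ℕ} (h : Fin t → A × ℝ) (b : A) : M.width lam h b ^ 2 ≤ 1 / lam := by
  rw [M.width_sq hlam]
  exact (M.posDef_gram hlam h).inv_quadratic_le hlam (M.mul_dotProduct_self_le_gram h) _
    (M.feat_dotProduct_self_le b)

theorem width_le {t : ℕ} (h : Fin t → A × ℝ) (b : A) : M.width lam h b ≤ 1 / Real.sqrt lam := by
  rw [← Real.sqrt_one, ← Real.sqrt_div zero_le_one]
  exact Real.le_sqrt_of_sq_le (M.width_sq_le hlam h b)

/-- The rewards satisfy ∑ r x = S + (V - Λ)α with S the noise sum, so the estimation error is V⁻¹(S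
- Λα): a noise part and a regularization bias. -/
theorem abs_mean_estimate_sub_le (α : EuclideanSpace ℝ ι) {t : ℕ} (h : Fin t → A × ℝ) (b : A) :
    |M.mean (M.estimate lam h) b - M.mean α b| ≤
      M.width lam h b * (Real.sqrt (M.noiseNormSq lam α h) + M.lamNorm lam α) := by
  set Λ : Matrix ι ι ℝ := Matrix.diagonal fun i => M.eig i + lam with hΛ
  have hV := M.posDef_gram hlam h
  have h1 : ∑ s, (h s).2 • (M.feat (h s).1).ofLp =
      M.noiseSum α h - Λ.mulVec α.ofLp + (M.gram lam h).mulVec α.ofLp := by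
    have e1 : (M.gram lam h).mulVec α.ofLp = Λ.mulVec α.ofLp
        + ∑ s, M.mean α (h s).1 • (M.feat (h s).1).ofLp := by
      rw [gram, Matrix.add_mulVec, Matrix.sum_mulVec]
      congr 1
      refine Finset.sum_congr rfl fun s _ => ?_
      rw [Matrix.vecMulVec_mulVec, ← mean_eq_dotProduct]
      ext i
      simp [mul_comm]
    rw [e1, noiseSum]
    simp only [sub_smul, Finset.sum_sub_distrib]
    abel
  have h2 : M.mean (M.estimate lam h) b - M.mean α b =
      (M.feat b).ofLp ⬝ᵥ (M.gram lam h)⁻¹.mulVec (M.noiseSum α h - Λ.mulVec α.ofLp) := by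
    rw [mean_eq_dotProduct, mean_eq_dotProduct, estimate, h1, Matrix.mulVec_add,
      hV.inv_mulVec_mulVec, dotProduct_add]
    ring
  rw [h2, M.lamNorm_eq]
  exact hV.abs_dotProduct_inv_sub_le (M.posDef_diagonal hlam).posSemidef (M.diagonal_le_gram h) _ _ _

omit [DecidableEq ι] in
theorem abs_mean_le (α : EuclideanSpace ℝ ι) (b : A) :
    |M.mean α b| ≤ M.lamNorm lam α / Real.sqrt lam := by
  have h1 : ‖α‖ ≤ M.lamNorm lam α / Real.sqrt lam := by
    rw [le_div_iff₀ (Real.sqrt_pos.mpr hlam), lamNorm, EuclideanSpace.norm_eq,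
      ← Real.sqrt_mul (Finset.sum_nonneg fun i _ => sq_nonneg _), Finset.sum_mul]
    refine Real.sqrt_le_sqrt (Finset.sum_le_sum fun i _ => ?_)
    rw [Real.norm_eq_abs, sq_abs, mul_comm]
    exact mul_le_mul_of_nonneg_right (by linarith [M.eig_nonneg i]) (sq_nonneg _)
  rw [mean]
  refine (abs_real_inner_le_norm _ _).trans ?_
  calc ‖M.feat b‖ * ‖α‖ ≤ 1 * ‖α‖ :=
        mul_le_mul_of_nonneg_right (M.norm_feat_le b) (norm_nonneg _)
    _ ≤ _ := by rwa [one_mul]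

omit hlam in
theorem gram_snoc {t : ℕ} (h : Fin t → A × ℝ) (p : A × ℝ) :
    M.gram lam (Fin.snoc (α := fun _ => A × ℝ) h p) =
      M.gram lam h + Matrix.vecMulVec (M.feat p.1).ofLp (M.feat p.1).ofLp := by
  simp [gram, Fin.sum_univ_castSucc, add_assoc]

omit [DecidableEq ι] hlam in
theorem noiseSum_snoc (α : EuclideanSpace ℝ ι) {t : ℕ} (h : Fin t → A × ℝ) (p : A × ℝ) :
    M.noiseSum α (Fin.snoc (α := fun _ => A × ℝ) h p) =
      M.noiseSum α h + (p.2 - M.mean α p.1) • (M.feat p.1).ofLp := by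
  simp [noiseSum, Fin.sum_univ_castSucc]

theorem det_gram_snoc {t : ℕ} (h : Fin t → A × ℝ) (p : A × ℝ) :
    (M.gram lam (Fin.snoc (α := fun _ => A × ℝ) h p)).det =
      (M.gram lam h).det * (1 + M.width lam h p.1 ^ 2) := by
  rw [gram_snoc, (M.posDef_gram hlam h).det_add_vecMulVec_self, M.width_sq hlam]

theorem noiseNormSq_snoc (α : EuclideanSpace ℝ ι) {t : ℕ} (h : Fin t → A × ℝ) (p : A × ℝ) :
    M.noiseNormSq lam α (Fin.snoc (α := fun _ => A × ℝ) h p) =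
      M.noiseNormSq lam α h +
        (M.width lam h p.1 ^ 2 * (p.2 - M.mean α p.1) ^ 2 +
          2 * ((M.feat p.1).ofLp ⬝ᵥ (M.gram lam h)⁻¹.mulVec (M.noiseSum α h)) *
            (p.2 - M.mean α p.1) -
          ((M.feat p.1).ofLp ⬝ᵥ (M.gram lam h)⁻¹.mulVec (M.noiseSum α h)) ^ 2) /
        (1 + M.width lam h p.1 ^ 2) := by
  rw [noiseNormSq, noiseSum_snoc, gram_snoc,
    (M.posDef_gram hlam h).inv_add_vecMulVec_quadratic, M.width_sq hlam]
  rfl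

omit [DecidableEq ι] hlam in
theorem history_succ {Ω : Type*} (α : EuclideanSpace ℝ ι) (a : ℕ → Ω → A) (ε : ℕ → Ω → ℝ)
    (t : ℕ) (ω : Ω) :
    M.history α a ε (t + 1) ω = Fin.snoc (α := fun _ => A × ℝ) (M.history α a ε t ω)
      (a t ω, M.mean α (a t ω) + ε t ω) := by
  funext s
  refine Fin.lastCases ?_ (fun i => ?_) s
  · rw [Fin.snoc_last]; rfl
  · rw [Fin.snoc_castSucc]; rfl

omit [DecidableEq ι] hlam in
theorem one_le_zeroMult : 1 ≤ M.zeroMult := by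
  obtain ⟨i, hi⟩ := M.exists_eig_eq_zero
  have : Nonempty {i : ι // M.eig i = 0} := ⟨⟨i, hi⟩⟩
  exact Nat.card_pos

omit [DecidableEq ι] in
theorem log_pos_of_one_le {T : ℕ} (hT : 1 ≤ T) :
    0 < Real.log (1 + T / (M.zeroMult * lam)) := by
  refine Real.log_pos ?_
  have h1 : (0 : ℝ) < T := by exact_mod_cast hT
  have h2 : (0 : ℝ) < M.zeroMult := by exact_mod_cast M.one_le_zeroMult
  have : 0 < (T : ℝ) / (M.zeroMult * lam) := by positivity
  linarith

omit [DecidableEq ι] in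
theorem sum_log_le_effDim_mul {T : ℕ} (hT : 1 ≤ T) {t : ι → ℝ} (ht : ∀ i, 0 ≤ t i)
    (hsum : ∑ i, t i = T) :
    ∑ i, Real.log (1 + t i / (M.eig i + lam)) ≤
      M.effDim lam T * Real.log (1 + T / (M.zeroMult * lam)) := by
  have hL := M.log_pos_of_one_le hlam hT
  rw [← div_le_iff₀ hL]
  refine le_trans ?_ (Nat.le_ceil _)
  -- The supremum is only meaningful for a set bounded above; T/λ is a bound because log (1 + x) ≤ x
  -- and every λᵢ is at least λ.
  refine div_le_div_of_nonneg_right (le_csSup ⟨T / lam, ?_⟩ ⟨t, ht, hsum, rfl⟩) hL.le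
  rintro y ⟨u, hu, hus, rfl⟩
  rw [← hus, Finset.sum_div]
  refine Finset.sum_le_sum fun i _ => ?_
  have h1 : 0 ≤ u i / (M.eig i + lam) := div_nonneg (hu i) (by linarith [M.eig_nonneg i])
  calc Real.log (1 + u i / (M.eig i + lam)) ≤ u i / (M.eig i + lam) := by
        have := Real.log_le_sub_one_of_pos (x := 1 + u i / (M.eig i + lam)) (by linarith)
        linarith
    _ ≤ u i / lam := div_le_div_of_nonneg_left (hu i) hlam (by linarith [M.eig_nonneg i])

/-- Hadamard's inequality discards the off-diagonal entries. The diagonal increments have total mass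
at most t, since features have norm at most one, so they compete in the maximum defining the
effective dimension. -/
theorem log_det_gram_le {T t : ℕ} (hT : 1 ≤ T) (ht : t ≤ T) (h : Fin t → A × ℝ) :
    Real.log ((M.gram lam h).det / (Matrix.diagonal fun i => M.eig i + lam).det) ≤
      M.effDim lam T * Real.log (1 + T / (M.zeroMult * lam)) := by
  obtain ⟨i₀, -⟩ := M.exists_eig_eq_zero
  have hpos (i : ι) : 0 < M.eig i + lam := by linarith [M.eig_nonneg i]
  set u : ι → ℝ := fun i => ∑ s, (M.feat (h s).1).ofLp i * (M.feat (h s).1).ofLp i with hu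
  have hu0 (i : ι) : 0 ≤ u i := Finset.sum_nonneg fun s _ => mul_self_nonneg _
  have husum : ∑ i, u i ≤ T := by
    rw [hu, Finset.sum_comm]
    calc _ ≤ ∑ _s : Fin t, (1 : ℝ) :=
          Finset.sum_le_sum fun s _ => M.feat_dotProduct_self_le (h s).1
      _ = t := by simp
      _ ≤ T := by exact_mod_cast ht
  -- The unused mass is placed on an arbitrary coordinate, because the constraint demands total mass
  -- exactly T.
  set w : ι → ℝ := fun i => u i + if i = i₀ then (T - ∑ j, u j) else 0 with hw
  have huw (i : ι) : u i ≤ w i := by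
    simp only [hw]
    split_ifs
    · linarith
    · simp
  have hdiag (i : ι) : M.gram lam h i i = (M.eig i + lam) * (1 + u i / (M.eig i + lam)) := by
    rw [mul_add, mul_div_cancel₀ _ (hpos i).ne', mul_one]
    simp [gram, Matrix.sum_apply, Matrix.vecMulVec_apply, hu]
  have hone (i : ι) : 0 < 1 + u i / (M.eig i + lam) := by
    have := div_nonneg (hu0 i) (hpos i).le
    linarith
  have h1 : (M.gram lam h).det / (Matrix.diagonal fun i => M.eig i + lam).det ≤
      ∏ i, (1 + u i / (M.eig i + lam)) := by
    rw [div_le_iff₀ (M.posDef_diagonal hlam).det_pos, Matrix.det_diagonal,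
      ← Finset.prod_mul_distrib]
    refine (M.posDef_gram hlam h).det_le_prod_diag.trans (le_of_eq ?_)
    exact Finset.prod_congr rfl fun i _ => by rw [hdiag, mul_comm]
  calc _ ≤ Real.log (∏ i, (1 + u i / (M.eig i + lam))) :=
        Real.log_le_log (div_pos (M.posDef_gram hlam h).det_pos
          (M.posDef_diagonal hlam).det_pos) h1
    _ = ∑ i, Real.log (1 + u i / (M.eig i + lam)) :=
        Real.log_prod fun i _ => (hone i).ne'
    _ ≤ ∑ i, Real.log (1 + w i / (M.eig i + lam)) := by
        refine Finset.sum_le_sum fun i _ => Real.log_le_log (hone i) ?_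
        have := div_le_div_of_nonneg_right (huw i) (hpos i).le
        linarith
    _ ≤ _ := by
        refine M.sum_log_le_effDim_mul hlam hT (fun i => (hu0 i).trans (huw i)) ?_
        simp [hw, Finset.sum_add_distrib]

omit [DecidableEq ι] in
-- Spreading the mass T evenly over the K zero eigenvalues attains K log (1 + T/(Kλ)).
theorem zeroMult_le_effDim {T : ℕ} (hT : 1 ≤ T) : M.zeroMult ≤ M.effDim lam T := by
  classical
  have hL := M.log_pos_of_one_le hlam hT
  have hK : (0 : ℝ) < M.zeroMult := by exact_mod_cast M.one_le_zeroMult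
  have hcard : (M.zeroMult : ℝ) = ((Finset.univ.filter fun i => M.eig i = 0).card : ℝ) := by
    rw [zeroMult, Nat.card_eq_fintype_card, Fintype.card_subtype]
  have h1 := M.sum_log_le_effDim_mul hlam hT
    (t := fun i => if M.eig i = 0 then (T : ℝ) / M.zeroMult else 0)
    (fun i => by split_ifs <;> positivity) (by
      rw [← Finset.sum_filter, Finset.sum_const, nsmul_eq_mul, ← hcard]
      field_simp)
  have h2 : ∑ i, Real.log (1 + (if M.eig i = 0 then (T : ℝ) / M.zeroMult else 0) /
      (M.eig i + lam)) = M.zeroMult * Real.log (1 + T / (M.zeroMult * lam)) := by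
    rw [hcard, ← nsmul_eq_mul, ← Finset.sum_const, Finset.sum_filter]
    refine Finset.sum_congr rfl fun i _ => ?_
    split_ifs with h
    · rw [h, zero_add, div_div]
    · simp
  rw [h2] at h1
  exact_mod_cast le_of_mul_le_mul_right h1 hL

/-- The elliptical potential bound. -/
theorem sum_width_sq_le {Ω : Type*} (α : EuclideanSpace ℝ ι) (a : ℕ → Ω → A) (ε : ℕ → Ω → ℝ)
    {T : ℕ} (hT : 1 ≤ T) (ω : Ω) :
    ∑ t ∈ Finset.range T, M.width lam (M.history α a ε t ω) (a t ω) ^ 2 ≤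
      (1 + 1 / lam) * (M.effDim lam T * Real.log (1 + T / (M.zeroMult * lam))) := by
  -- The determinant ratio is the telescoping product of the factors 1 + width².
  have hdet (t : ℕ) : Real.log ((M.gram lam (M.history α a ε t ω)).det /
      (Matrix.diagonal fun i => M.eig i + lam).det) =
      ∑ s ∈ Finset.range t, Real.log (1 + M.width lam (M.history α a ε s ω) (a s ω) ^ 2) := by
    have hD := (M.posDef_diagonal hlam).det_pos
    induction t with
    | zero => simp [gram]
    | succ t ih =>
      have hV := (M.posDef_gram hlam (M.history α a ε t ω)).det_pos
      rw [Finset.sum_range_succ, ← ih, history_succ, M.det_gram_snoc hlam, mul_div_right_comm,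
        Real.log_mul (div_pos hV hD).ne' (by positivity)]
  refine le_trans ?_ (mul_le_mul_of_nonneg_left
    (M.log_det_gram_le hlam hT le_rfl (M.history α a ε T ω)) (by positivity))
  rw [hdet, Finset.mul_sum]
  refine Finset.sum_le_sum fun t _ => ?_
  set u := M.width lam (M.history α a ε t ω) (a t ω) ^ 2 with hu
  have hu0 : 0 ≤ u := sq_nonneg _
  have hu1 : u ≤ 1 / lam := M.width_sq_le hlam _ _
  -- This gives u ≤ (1 + u) log (1 + u), and u ≤ 1/λ bounds the factor in front.
  have h1 : 1 - (1 + u)⁻¹ ≤ Real.log (1 + u) := Real.one_sub_inv_le_log_of_pos (by linarith)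
  have h2 : 1 - (1 + u)⁻¹ = u / (1 + u) := by field_simp; ring
  rw [h2, div_le_iff₀ (by linarith)] at h1
  have h3 : 0 ≤ Real.log (1 + u) := Real.log_nonneg (by linarith)
  nlinarith

end Deterministic

end SpectralBandit

/-! ### Measurability of functions of the history. -/

namespace SpectralBandit

section Measurability

variable {A ι : Type*} [Fintype ι] [DecidableEq ι] (M : SpectralBandit A ι)
  [MeasurableSpace A] [MeasurableSingletonClass A] [Finite A]

theorem measurable_comp_arms {Γ : Type*} [MeasurableSpace Γ] {t : ℕ} (F : (Fin t → A) → Γ) :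
    Measurable fun h : Fin t → A × ℝ => F fun s => (h s).1 :=
  (Measurable.of_discrete (f := F)).comp (by fun_prop)

variable (lam : ℝ)

/-- The Gram matrix sees only the arms, and there are finitely many arm sequences; so F, for
instance inversion, needs no regularity. -/
theorem measurable_comp_gram {Γ : Type*} [MeasurableSpace Γ] (F : Matrix ι ι ℝ → Γ) {t : ℕ} :
    Measurable fun h : Fin t → A × ℝ => F (M.gram lam h) :=
  measurable_comp_arms fun c => F (M.gram lam fun s => (c s, 0))

theorem measurable_width {t : ℕ} (b : A) :
    Measurable fun h : Fin t → A × ℝ => M.width lam h b :=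
  M.measurable_comp_gram lam fun V => Real.sqrt ((M.feat b).ofLp ⬝ᵥ V⁻¹.mulVec (M.feat b).ofLp)

theorem measurable_comp_arm {Γ : Type*} [MeasurableSpace Γ] {t : ℕ} (s : Fin t) (F : A → Γ) :
    Measurable fun h : Fin t → A × ℝ => F (h s).1 :=
  (Measurable.of_discrete (f := F)).comp (by fun_prop)

omit [DecidableEq ι] in
theorem measurable_noiseSum (α : EuclideanSpace ℝ ι) {t : ℕ} (i : ι) :
    Measurable fun h : Fin t → A × ℝ => M.noiseSum α h i := by
  simp only [noiseSum, Finset.sum_apply, Pi.smul_apply, smul_eq_mul]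
  refine Finset.measurable_sum _ fun s _ => Measurable.mul (Measurable.sub (by fun_prop) ?_) ?_
  · exact measurable_comp_arm s (M.mean α)
  · exact measurable_comp_arm s fun b => (M.feat b).ofLp i

theorem measurable_dotProduct_inv_mulVec {t : ℕ} {u w : (Fin t → A × ℝ) → ι → ℝ}
    (hu : ∀ i, Measurable fun h => u h i) (hw : ∀ i, Measurable fun h => w h i) :
    Measurable fun h => u h ⬝ᵥ (M.gram lam h)⁻¹.mulVec (w h) := by
  simp only [dotProduct, Matrix.mulVec]
  exact Finset.measurable_sum _ fun i _ => (hu i).mul <| Finset.measurable_sum _ fun j _ =>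
    (M.measurable_comp_gram lam fun V => V⁻¹ i j).mul (hw j)

theorem measurable_noiseNormSq (α : EuclideanSpace ℝ ι) {t : ℕ} :
    Measurable fun h : Fin t → A × ℝ => M.noiseNormSq lam α h :=
  M.measurable_dotProduct_inv_mulVec lam (M.measurable_noiseSum α) (M.measurable_noiseSum α)

theorem measurable_mean_estimate {t : ℕ} (b : A) :
    Measurable fun h : Fin t → A × ℝ => M.mean (M.estimate lam h) b := by
  simp only [mean_eq_dotProduct, estimate]
  refine M.measurable_dotProduct_inv_mulVec lam (fun i => measurable_const) fun i => ?_
  simp only [Finset.sum_apply, Pi.smul_apply, smul_eq_mul]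
  exact Finset.measurable_sum _ fun s _ => Measurable.mul (by fun_prop)
    (measurable_comp_arm s fun b => (M.feat b).ofLp i)

omit [DecidableEq ι] [Finite A] in
theorem measurable_history [Finite A] {Ω : Type*} [MeasurableSpace Ω] (α : EuclideanSpace ℝ ι)
    {a : ℕ → Ω → A} {ε : ℕ → Ω → ℝ} {T : ℕ} (ha : ∀ t < T, Measurable (a t))
    (hε : ∀ t < T, Measurable (ε t)) {t : ℕ} (ht : t ≤ T) :
    Measurable (M.history α a ε t) := by
  refine measurable_pi_lambda _ fun s => ?_
  have hs : (s : ℕ) < T := s.2.trans_le ht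
  exact (ha s hs).prodMk (((Measurable.of_discrete (f := M.mean α)).comp (ha s hs)).add (hε s hs))

omit [DecidableEq ι] [MeasurableSingletonClass A] [Finite A] in
theorem comap_history_mono {Ω : Type*} (α : EuclideanSpace ℝ ι)
    (a : ℕ → Ω → A) (ε : ℕ → Ω → ℝ) {s t : ℕ} (hst : s ≤ t) :
    MeasurableSpace.comap (M.history α a ε s) inferInstance ≤
      MeasurableSpace.comap (M.history α a ε t) inferInstance := by
  have h1 : M.history α a ε s =
      (fun (h : Fin t → A × ℝ) (i : Fin s) => h (Fin.castLE hst i)) ∘ M.history α a ε t := rfl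
  rw [h1, ← MeasurableSpace.comap_comp]
  refine MeasurableSpace.comap_mono (Measurable.comap_le ?_)
  fun_prop

end Measurability

/-! ### The self-normalized supermartingale and accuracy of the estimates. -/

section Confidence

variable {A ι Ω : Type*} [Fintype ι] [DecidableEq ι] [MeasurableSpace A]
  [MeasurableSingletonClass A] [Finite A] [MeasurableSpace Ω] {P : Measure Ω}
  [IsProbabilityMeasure P] {M : SpectralBandit A ι} {lam R v : ℝ} {α : EuclideanSpace ℝ ι} {T : ℕ}
  {αs : ℕ → Ω → EuclideanSpace ℝ ι} {a : ℕ → Ω → A} {ε : ℕ → Ω → ℝ}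

variable (M lam α) in
/-- The self-normalized exponential supermartingale, as a function of the history. -/
noncomputable def selfNormExp (ρ : ℝ) {t : ℕ} (h : Fin t → A × ℝ) : ℝ :=
  Real.exp (M.noiseNormSq lam α h / (2 * ρ ^ 2)) /
    Real.sqrt ((M.gram lam h).det / (Matrix.diagonal fun i => M.eig i + lam).det)

omit [Finite A] [MeasurableSpace A] [MeasurableSingletonClass A] in
-- Sherman–Morrison updates the exponent and the determinant lemma the normalization. The resulting
-- factor is the one whose conditional mean `lintegral_exp_mixture_le` bounds by one.
theorem selfNormExp_snoc (hlam : 0 < lam) (ρ : ℝ) {t : ℕ} (h : Fin t → A × ℝ)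
    (b : A) (e : ℝ) :
    M.selfNormExp lam α ρ (Fin.snoc (α := fun _ => A × ℝ) h (b, M.mean α b + e)) =
      M.selfNormExp lam α ρ h * ((1 / Real.sqrt (1 + M.width lam h b ^ 2)) *
        Real.exp ((M.width lam h b ^ 2 * e ^ 2 +
          2 * ((M.feat b).ofLp ⬝ᵥ (M.gram lam h)⁻¹.mulVec (M.noiseSum α h)) * e -
          ((M.feat b).ofLp ⬝ᵥ (M.gram lam h)⁻¹.mulVec (M.noiseSum α h)) ^ 2) /
        (2 * ρ ^ 2 * (1 + M.width lam h b ^ 2)))) := by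
  have hD := (M.posDef_diagonal hlam).det_pos
  have hV := (M.posDef_gram hlam h).det_pos
  have hw : 0 < 1 + M.width lam h b ^ 2 := by positivity
  rw [selfNormExp, M.noiseNormSq_snoc hlam, M.det_gram_snoc hlam, selfNormExp]
  simp only [add_sub_cancel_left]
  rw [mul_div_right_comm, Real.sqrt_mul (div_pos hV hD).le, add_div, Real.exp_add, div_div,
    mul_comm (1 + M.width lam h b ^ 2) (2 * ρ ^ 2)]
  have h1 := (Real.sqrt_pos.mpr (div_pos hV hD)).ne'
  have h2 := (Real.sqrt_pos.mpr hw).ne'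
  field_simp

/-- The self-normalized tail bound for vector-valued martingales along a run. -/
theorem measure_exists_noiseNormSq_gt_le (hlam : 0 < lam)
    (hrun : IsSpectralTSRun M lam R v α T P αs a ε) (hR : 0 ≤ R) {ρ : ℝ} (hρ : 0 < ρ)
    (hRρ : R ≤ ρ) (hT : 1 ≤ T) {δ : ℝ} (hδ : 0 < δ) :
    P {ω | ∃ t ≤ T, ρ ^ 2 * (2 * Real.log (1 / δ) +
        M.effDim lam T * Real.log (1 + T / (M.zeroMult * lam))) <
          M.noiseNormSq lam α (M.history α a ε t ω)} ≤ ENNReal.ofReal δ := by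
  have hH (t : ℕ) (ht : t ≤ T) : Measurable (M.history α a ε t) :=
    M.measurable_history α hrun.measurable_arm hrun.measurable_noise ht
  have hdetpos {t : ℕ} (h : Fin t → A × ℝ) :
      0 < (M.gram lam h).det / (Matrix.diagonal fun i => M.eig i + lam).det :=
    div_pos (M.posDef_gram hlam h).det_pos (M.posDef_diagonal hlam).det_pos
  have hZm (t : ℕ) : Measurable fun h : Fin t → A × ℝ =>
      ENNReal.ofReal (M.selfNormExp lam α ρ h) := by
    refine ENNReal.measurable_ofReal.comp (Measurable.div ?_ ?_)
    · exact ((M.measurable_noiseNormSq lam α).div_const _).exp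
    · exact M.measurable_comp_gram lam fun V =>
        Real.sqrt (V.det / (Matrix.diagonal fun i => M.eig i + lam).det)
  have hville := mul_measure_exists_le_of_supermartingale P (T := T)
    (Y := fun t ω => ENNReal.ofReal (M.selfNormExp lam α ρ (M.history α a ε t ω)))
    (ℱ := fun t => MeasurableSpace.comap (M.history α a ε t) inferInstance)
    (fun t ht => (hH t ht).comap_le) (fun t _ s hst => M.comap_history_mono α a ε hst)
    (fun t _ => (hZm t).comp (comap_measurable _)) (by
      have hD := (M.posDef_diagonal hlam).det_pos
      simp [selfNormExp, noiseNormSq, noiseSum, gram, -Matrix.det_diagonal, div_self hD.ne'])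
    (by
      rintro t ht _ ⟨B, hB, rfl⟩
      have hX : Measurable fun ω => (M.history α a ε t ω, a t ω) :=
        (hH t ht.le).prodMk (hrun.measurable_arm t ht)
      have hε := hrun.measurable_noise t ht
      have hB' : MeasurableSet (M.history α a ε t ⁻¹' B) := hH t ht.le hB
      set q : ((Fin t → A × ℝ) × A) × ℝ → ℝ := fun p =>
        (1 / Real.sqrt (1 + M.width lam p.1.1 p.1.2 ^ 2)) *
        Real.exp ((M.width lam p.1.1 p.1.2 ^ 2 * p.2 ^ 2 +
          2 * ((M.feat p.1.2).ofLp ⬝ᵥ (M.gram lam p.1.1)⁻¹.mulVec (M.noiseSum α p.1.1)) * p.2 -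
          ((M.feat p.1.2).ofLp ⬝ᵥ (M.gram lam p.1.1)⁻¹.mulVec (M.noiseSum α p.1.1)) ^ 2) /
        (2 * ρ ^ 2 * (1 + M.width lam p.1.1 p.1.2 ^ 2))) with hq
      have hwm : Measurable fun p : (Fin t → A × ℝ) × A => M.width lam p.1 p.2 :=
        measurable_from_prod_countable_left fun b => M.measurable_width lam b
      have hmm : Measurable fun p : (Fin t → A × ℝ) × A =>
          (M.feat p.2).ofLp ⬝ᵥ (M.gram lam p.1)⁻¹.mulVec (M.noiseSum α p.1) :=
        measurable_from_prod_countable_left fun b => M.measurable_dotProduct_inv_mulVec lam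
          (u := fun _ => (M.feat b).ofLp) (fun i => measurable_const) (M.measurable_noiseSum α)
      have hwm' : Measurable fun p : ((Fin t → A × ℝ) × A) × ℝ => M.width lam p.1.1 p.1.2 :=
        hwm.comp measurable_fst
      have hmm' : Measurable fun p : ((Fin t → A × ℝ) × A) × ℝ =>
          (M.feat p.1.2).ofLp ⬝ᵥ (M.gram lam p.1.1)⁻¹.mulVec (M.noiseSum α p.1.1) :=
        hmm.comp measurable_fst
      have hqm : Measurable q := by fun_prop
      set F : ((Fin t → A × ℝ) × A) × ℝ → ENNReal := fun p =>
        (B.indicator (fun h => ENNReal.ofReal (M.selfNormExp lam α ρ h)) p.1.1) *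
          ENNReal.ofReal (q p) with hF
      have hBm : Measurable (B.indicator fun h => ENNReal.ofReal (M.selfNormExp lam α ρ h)) :=
        (hZm t).indicator hB
      have hFm : Measurable F :=
        (hBm.comp (measurable_fst.comp measurable_fst)).mul (ENNReal.measurable_ofReal.comp hqm)
      have hsucc (ω : Ω) : (M.history α a ε t ⁻¹' B).indicator
          (fun ω => ENNReal.ofReal (M.selfNormExp lam α ρ (M.history α a ε (t + 1) ω))) ω =
          F ((M.history α a ε t ω, a t ω), ε t ω) := by
        simp only [hF]
        by_cases hωB : M.history α a ε t ω ∈ B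
        · rw [Set.indicator_of_mem hωB, Set.indicator_of_mem (Set.mem_preimage.mpr hωB),
            M.history_succ, selfNormExp_snoc hlam, ENNReal.ofReal_mul]
          exact div_nonneg (Real.exp_nonneg _) (Real.sqrt_nonneg _)
        · rw [Set.indicator_of_notMem hωB, Set.indicator_of_notMem (by simpa using hωB), zero_mul]
      rw [← lintegral_indicator hB', ← lintegral_indicator hB']
      simp_rw [hsucc]
      rw [lintegral_eq_lintegral_condDistrib P hX hε hFm]
      refine lintegral_mono_ae ?_
      filter_upwards [ae_forall_lintegral_exp_condDistrib_le P hX hε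
        (hrun.noise_exp_integrable t ht) (hrun.noise_subgaussian t ht)] with ω hω
      -- Sub-Gaussianity is relaxed from R to ρ ≥ R, since the mixture divides by the scale and R
      -- may be zero.
      have hω' (s : ℝ) : ∫⁻ e, ENNReal.ofReal (Real.exp (s * e))
          ∂condDistrib (ε t) (fun ω => (M.history α a ε t ω, a t ω)) P
            (M.history α a ε t ω, a t ω) ≤ ENNReal.ofReal (Real.exp (ρ ^ 2 * s ^ 2 / 2)) := by
        refine (hω s).trans (ENNReal.ofReal_le_ofReal (Real.exp_le_exp.mpr ?_))
        gcongr
      have hmix := lintegral_exp_mixture_le hρ hω'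
        (sq_nonneg (M.width lam (M.history α a ε t ω) (a t ω)))
        ((M.feat (a t ω)).ofLp ⬝ᵥ (M.gram lam (M.history α a ε t ω))⁻¹.mulVec
          (M.noiseSum α (M.history α a ε t ω)))
      have hw0 : 0 < Real.sqrt (1 + M.width lam (M.history α a ε t ω) (a t ω) ^ 2) :=
        Real.sqrt_pos.mpr (by positivity)
      have hq1 : ∫⁻ e, ENNReal.ofReal (q ((M.history α a ε t ω, a t ω), e))
          ∂condDistrib (ε t) (fun ω => (M.history α a ε t ω, a t ω)) P
            (M.history α a ε t ω, a t ω) ≤ 1 := by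
        simp only [hq, ENNReal.ofReal_mul (one_div_pos.mpr hw0).le]
        rw [lintegral_const_mul _ (by fun_prop)]
        refine (mul_le_mul_right hmix _).trans ?_
        rw [← ENNReal.ofReal_mul (one_div_pos.mpr hw0).le, one_div_mul_cancel hw0.ne',
          ENNReal.ofReal_one]
      simp only [hF]
      rw [lintegral_const_mul _ (by fun_prop)]
      refine (mul_le_mul_right hq1 _).trans ?_
      rw [mul_one]
      rfl) (ENNReal.ofReal (1 / δ))
  -- A large noise norm forces the supermartingale above 1/δ, because half the log-determinant in
  -- its denominator is at most dL/2.
  have hsub : {ω | ∃ t ≤ T, ρ ^ 2 * (2 * Real.log (1 / δ) +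
        M.effDim lam T * Real.log (1 + T / (M.zeroMult * lam))) <
          M.noiseNormSq lam α (M.history α a ε t ω)} ⊆
      {ω | ∃ t ≤ T, ENNReal.ofReal (1 / δ) ≤
        ENNReal.ofReal (M.selfNormExp lam α ρ (M.history α a ε t ω))} := by
    rintro ω ⟨t, ht, hω⟩
    refine ⟨t, ht, ENNReal.ofReal_le_ofReal ?_⟩
    have h1 := M.log_det_gram_le hlam hT ht (M.history α a ε t ω)
    rw [selfNormExp, le_div_iff₀ (Real.sqrt_pos.mpr (hdetpos _)),
      ← Real.exp_log (mul_pos (one_div_pos.mpr hδ) (Real.sqrt_pos.mpr (hdetpos _)))]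
    rw [Real.log_mul (one_div_pos.mpr hδ).ne' (Real.sqrt_pos.mpr (hdetpos _)).ne',
      Real.log_sqrt (hdetpos _).le]
    refine Real.exp_le_exp.mpr ?_
    rw [le_div_iff₀ (by positivity)]
    have hρ2 : 0 < ρ ^ 2 := by positivity
    nlinarith
  refine (measure_mono hsub).trans ?_
  rw [one_div, ENNReal.ofReal_inv_of_pos hδ] at hville ⊢
  have h0 : ENNReal.ofReal δ ≠ 0 := (ENNReal.ofReal_pos.mpr hδ).ne'
  rwa [mul_comm, ← div_eq_mul_inv, ENNReal.div_le_iff h0 ENNReal.ofReal_ne_top, one_mul] at hville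

end Confidence

end SpectralBandit

/-! ### Conditional probability bounds as inequalities between integrals. -/

section Disintegration

variable {Ω β γ : Type*} [MeasurableSpace Ω] [MeasurableSpace β] [MeasurableSpace γ]
  [StandardBorelSpace γ] [Nonempty γ]

theorem MeasureTheory.integrable_of_measurable_of_abs_le {P : Measure Ω} [IsFiniteMeasure P]
    {f : Ω → ℝ} (hf : Measurable f) {K : ℝ} (hK : ∀ ω, |f ω| ≤ K) : Integrable f P :=
  Integrable.of_bound hf.aestronglyMeasurable K (Filter.Eventually.of_forall hK)

variable (P : Measure Ω) [IsProbabilityMeasure P] {X : Ω → β} {Y : Ω → γ} (hX : Measurable X)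
  (hY : Measurable Y) {φ : β → ℝ} (hφ : Measurable φ) {K : ℝ} (hφ0 : ∀ ω, 0 ≤ φ (X ω))
  (hφK : ∀ ω, φ (X ω) ≤ K) {S : Set (β × γ)} (hS : MeasurableSet S)

include hX hY hφ hφ0 hS in
theorem lintegral_mul_indicator_eq_condDistrib :
    ∫⁻ ω, ENNReal.ofReal (φ (X ω) * S.indicator 1 (X ω, Y ω)) ∂P =
      ∫⁻ ω, ENNReal.ofReal (φ (X ω)) * condDistrib Y X P (X ω) (Prod.mk (X ω) ⁻¹' S) ∂P := by
  have hF : Measurable fun p : β × γ => ENNReal.ofReal (φ p.1) * S.indicator 1 p :=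
    (ENNReal.measurable_ofReal.comp (hφ.comp measurable_fst)).mul (measurable_one.indicator hS)
  have h1 (ω : Ω) : ENNReal.ofReal (φ (X ω) * S.indicator 1 (X ω, Y ω)) =
      ENNReal.ofReal (φ (X ω)) * S.indicator 1 (X ω, Y ω) := by
    rw [ENNReal.ofReal_mul (hφ0 ω)]
    by_cases h : (X ω, Y ω) ∈ S <;> simp [h]
  simp_rw [h1]
  rw [lintegral_eq_lintegral_condDistrib P hX hY hF]
  refine lintegral_congr fun ω => ?_
  have hSω : MeasurableSet (Prod.mk (X ω) ⁻¹' S) := measurable_prodMk_left hS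
  have h2 (y : γ) : S.indicator (1 : β × γ → ENNReal) (X ω, y) =
      (Prod.mk (X ω) ⁻¹' S).indicator 1 y := rfl
  simp_rw [h2]
  rw [lintegral_const_mul _ (measurable_one.indicator hSω), lintegral_indicator_one hSω]

include hX hY hφ hφ0 hφK hS

omit [StandardBorelSpace γ] [Nonempty γ] in
theorem integrable_mul_indicator : Integrable (fun ω => φ (X ω) * S.indicator 1 (X ω, Y ω)) P := by
  refine integrable_of_measurable_of_abs_le (K := K) ?_ fun ω => ?_
  · exact (hφ.comp hX).mul ((measurable_one.indicator hS).comp (hX.prodMk hY))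
  · by_cases h : (X ω, Y ω) ∈ S
    · simpa [h, abs_of_nonneg (hφ0 ω)] using hφK ω
    · simpa [h] using (hφ0 ω).trans (hφK ω)

/-- The lower bound is required only where φ is nonzero, so that φ may carry the indicator of the
accurate histories, where alone optimism is guaranteed. -/
theorem mul_integral_le_of_le_condDistrib {r : ℝ} (hr : 0 ≤ r)
    (h : ∀ᵐ ω ∂P, φ (X ω) ≠ 0 →
      ENNReal.ofReal r ≤ condDistrib Y X P (X ω) (Prod.mk (X ω) ⁻¹' S)) :
    r * ∫ ω, φ (X ω) ∂P ≤ ∫ ω, φ (X ω) * S.indicator 1 (X ω, Y ω) ∂P := by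
  have hi : Integrable (fun ω => φ (X ω)) P :=
    integrable_of_measurable_of_abs_le (hφ.comp hX) fun ω => by
      rw [abs_of_nonneg (hφ0 ω)]; exact hφK ω
  have hn (ω : Ω) : 0 ≤ φ (X ω) * S.indicator 1 (X ω, Y ω) :=
    mul_nonneg (hφ0 ω) (Set.indicator_nonneg (fun _ _ => zero_le_one) _)
  rw [← integral_const_mul, ← ENNReal.ofReal_le_ofReal_iff (integral_nonneg hn),
    ofReal_integral_eq_lintegral_ofReal (integrable_mul_indicator P hX hY hφ hφ0 hφK hS)
      (Filter.Eventually.of_forall hn), lintegral_mul_indicator_eq_condDistrib P hX hY hφ hφ0 hS,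
    ofReal_integral_eq_lintegral_ofReal (hi.const_mul r)
      (Filter.Eventually.of_forall fun ω => mul_nonneg hr (hφ0 ω))]
  refine lintegral_mono_ae ?_
  filter_upwards [h] with ω hω
  by_cases h0 : φ (X ω) = 0
  · simp [h0]
  · rw [mul_comm, ENNReal.ofReal_mul (hφ0 ω)]
    exact mul_le_mul_right (hω h0) _

theorem integral_mul_indicator_le_of_condDistrib_le {r : ℝ} (hr : 0 ≤ r)
    (h : ∀ᵐ ω ∂P, condDistrib Y X P (X ω) (Prod.mk (X ω) ⁻¹' S) ≤ ENNReal.ofReal r) :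
    ∫ ω, φ (X ω) * S.indicator 1 (X ω, Y ω) ∂P ≤ r * ∫ ω, φ (X ω) ∂P := by
  have hi : Integrable (fun ω => φ (X ω)) P :=
    integrable_of_measurable_of_abs_le (hφ.comp hX) fun ω => by
      rw [abs_of_nonneg (hφ0 ω)]; exact hφK ω
  have hn (ω : Ω) : 0 ≤ φ (X ω) * S.indicator 1 (X ω, Y ω) :=
    mul_nonneg (hφ0 ω) (Set.indicator_nonneg (fun _ _ => zero_le_one) _)
  rw [← integral_const_mul, ← ENNReal.ofReal_le_ofReal_iff
      (integral_nonneg fun ω => mul_nonneg hr (hφ0 ω)),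
    ofReal_integral_eq_lintegral_ofReal (integrable_mul_indicator P hX hY hφ hφ0 hφK hS)
      (Filter.Eventually.of_forall hn), lintegral_mul_indicator_eq_condDistrib P hX hY hφ hφ0 hS,
    ofReal_integral_eq_lintegral_ofReal (hi.const_mul r)
      (Filter.Eventually.of_forall fun ω => mul_nonneg hr (hφ0 ω))]
  refine lintegral_mono_ae ?_
  filter_upwards [h] with ω hω
  rw [mul_comm r, ENNReal.ofReal_mul (hφ0 ω)]
  exact mul_le_mul_right hω _

end Disintegration

/-! ### One round: concentration, optimism and the benchmark. -/

namespace SpectralBandit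

section Step

variable {A ι Ω : Type*} [Fintype ι] [DecidableEq ι] [Fintype A] [Nonempty A] [MeasurableSpace A]
  [MeasurableSingletonClass A] [MeasurableSpace Ω] {P : Measure Ω}
  [IsProbabilityMeasure P] (M : SpectralBandit A ι) (lam : ℝ) {R : ℝ} (α : EuclideanSpace ℝ ι)
  {T : ℕ} {αs : ℕ → Ω → EuclideanSpace ℝ ι} {a : ℕ → Ω → A} {ε : ℕ → Ω → ℝ}

/-- The histories whose estimate is `β`-accurate for every arm. -/
def accurate (β : ℝ) (t : ℕ) : Set (Fin t → A × ℝ) :=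
  {h | ∀ b, |M.mean (M.estimate lam h) b - M.mean α b| ≤ β * M.width lam h b}

omit [Fintype A] [Nonempty A] in
theorem measurableSet_accurate [Finite A] (β : ℝ) (t : ℕ) :
    MeasurableSet (M.accurate lam α β t) := by
  have : M.accurate lam α β t =
      ⋂ b, {h | |M.mean (M.estimate lam h) b - M.mean α b| ≤ β * M.width lam h b} := by
    ext h; simp [accurate]
  rw [this]
  refine MeasurableSet.iInter fun b => measurableSet_le ?_ ?_
  · exact measurable_norm.comp ((M.measurable_mean_estimate lam b).sub_const _)
  · exact (M.measurable_width lam b).const_mul _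

/-- The pairs of a history and a sample at distance at most `r` widths from the estimate. -/
def concentrated (r : ℝ) (t : ℕ) : Set ((Fin t → A × ℝ) × EuclideanSpace ℝ ι) :=
  {p | ∀ b, |M.mean p.2 b - M.mean (M.estimate lam p.1) b| ≤ r * M.width lam p.1 b}

omit [DecidableEq ι] [Fintype A] [Nonempty A] [MeasurableSpace A]
  [MeasurableSingletonClass A] in
theorem measurable_mean (b : A) : Measurable fun θ : EuclideanSpace ℝ ι => M.mean θ b := by
  unfold mean
  fun_prop

omit [Fintype A] [Nonempty A] in
theorem measurableSet_concentrated [Finite A] (r : ℝ) (t : ℕ) :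
    MeasurableSet (M.concentrated lam r t) := by
  have : M.concentrated lam r t = ⋂ b, {p : (Fin t → A × ℝ) × EuclideanSpace ℝ ι |
      |M.mean p.2 b - M.mean (M.estimate lam p.1) b| ≤ r * M.width lam p.1 b} := by
    ext h; simp [concentrated]
  rw [this]
  refine MeasurableSet.iInter fun b => measurableSet_le ?_ ?_
  · exact measurable_norm.comp (((M.measurable_mean b).comp measurable_snd).sub
      ((M.measurable_mean_estimate lam b).comp measurable_fst))
  · exact ((M.measurable_width lam b).comp measurable_fst).const_mul _

/-- The largest mean reward. -/
noncomputable def maxMean : ℝ := Finset.univ.sup' Finset.univ_nonempty (M.mean α)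

/-- The largest lower confidence bound for the sampled rewards. -/
noncomputable def maxLower (r : ℝ) {t : ℕ} (h : Fin t → A × ℝ) : ℝ :=
  Finset.univ.sup' Finset.univ_nonempty
    fun b => M.mean (M.estimate lam h) b - r * M.width lam h b

theorem measurable_maxLower (r : ℝ) (t : ℕ) :
    Measurable fun h : Fin t → A × ℝ => M.maxLower lam r h := by
  have := Finset.measurable_sup' (s := (Finset.univ : Finset A)) Finset.univ_nonempty
    (f := fun b (h : Fin t → A × ℝ) => M.mean (M.estimate lam h) b - r * M.width lam h b)
    fun b _ => (M.measurable_mean_estimate lam b).sub ((M.measurable_width lam b).const_mul r)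
  convert this using 1
  ext h
  rw [maxLower, Finset.sup'_apply]

variable {M lam α}

omit [MeasurableSpace A] [MeasurableSingletonClass A] in
-- The played arm c is sampled at or above b, hence at or above the best mean; its lower confidence
-- bound is at most two radii r · width below its sample and is itself at most the benchmark.
theorem gap_le_of_optimistic {r : ℝ} {t : ℕ} {h : Fin t → A × ℝ} {θ : EuclideanSpace ℝ ι}
    {c b : A} (hc : ∀ b, M.mean θ b ≤ M.mean θ c) (hθ : (h, θ) ∈ M.concentrated lam r t)
    (hb : M.maxMean α ≤ M.mean θ b) :
    M.maxMean α - M.maxLower lam r h ≤ 2 * r * M.width lam h c := by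
  have h1 := (abs_le.mp (hθ c)).2
  have h2 : M.mean (M.estimate lam h) c - r * M.width lam h c ≤ M.maxLower lam r h :=
    Finset.le_sup' (fun b => M.mean (M.estimate lam h) b - r * M.width lam h b)
      (Finset.mem_univ c)
  have h3 := hc b
  simp only at h1
  linarith

omit [MeasurableSpace A] [MeasurableSingletonClass A] in
-- The played arm maximizes the samples, all of which exceed their lower bounds, so its sample is at
-- least the benchmark. Passing from the sample to the true mean costs r + β widths.
theorem regret_le_of_concentrated {β r : ℝ} {t : ℕ} {h : Fin t → A × ℝ} {θ : EuclideanSpace ℝ ι}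
    {c : A} (hc : ∀ b, M.mean θ b ≤ M.mean θ c) (hh : h ∈ M.accurate lam α β t)
    (hθ : (h, θ) ∈ M.concentrated lam r t) :
    M.maxMean α - M.mean α c ≤
      max (M.maxMean α - M.maxLower lam r h) 0 + (r + β) * M.width lam h c := by
  have h1 := (abs_le.mp (hθ c)).2
  have h2 := (abs_le.mp (hh c)).2
  have h3 : M.maxLower lam r h ≤ M.mean θ c := by
    refine Finset.sup'_le _ _ fun b _ => ?_
    have h4 := (abs_le.mp (hθ b)).1
    have h5 := hc b
    simp only at h4
    linarith
  have h6 := le_max_left (M.maxMean α - M.maxLower lam r h) 0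
  simp only at h1
  linarith

omit [MeasurableSpace A] [MeasurableSingletonClass A] in
-- A deterministic bound on the gap, needed for integrability.
theorem gap_le_of_accurate {β r : ℝ} (hlam : 0 < lam) (hβ : 0 ≤ β) (hr : 0 ≤ r) {t : ℕ}
    {h : Fin t → A × ℝ} (hh : h ∈ M.accurate lam α β t) :
    max (M.maxMean α - M.maxLower lam r h) 0 ≤ (r + β) * (1 / Real.sqrt lam) := by
  refine max_le ?_ (by positivity)
  rw [sub_le_iff_le_add]
  refine Finset.sup'_le _ _ fun b _ => ?_
  have h1 := (abs_le.mp (hh b)).1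
  have h2 : M.mean (M.estimate lam h) b - r * M.width lam h b ≤ M.maxLower lam r h :=
    Finset.le_sup' (fun b => M.mean (M.estimate lam h) b - r * M.width lam h b)
      (Finset.mem_univ b)
  have h3 := mul_le_mul_of_nonneg_left (M.width_le hlam h b) (add_nonneg hr hβ)
  linarith

omit [Fintype A] [Nonempty A] [MeasurableSpace A] [MeasurableSingletonClass A] in
theorem sqrt_cov_eq {v : ℝ} (hv : 0 ≤ v) {t : ℕ} (h : Fin t → A × ℝ) (b : A) :
    Real.sqrt ((M.feat b).ofLp ⬝ᵥ (v ^ 2 • (M.gram lam h)⁻¹).mulVec (M.feat b).ofLp) =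
      v * M.width lam h b := by
  rw [Matrix.smul_mulVec, dotProduct_smul, smul_eq_mul, Real.sqrt_mul (sq_nonneg v),
    Real.sqrt_sq hv, width]

omit [Nonempty A] [MeasurableSpace A] [MeasurableSingletonClass A] in
theorem gaussian_not_concentrated_le (hlam : 0 < lam) {v γ : ℝ} (hv : 0 ≤ v) (hγ : 0 ≤ γ)
    {t : ℕ} (h : Fin t → A × ℝ) :
    multivariateGaussian (M.estimate lam h) (v ^ 2 • (M.gram lam h)⁻¹)
        (Prod.mk h ⁻¹' (M.concentrated lam (γ * v) t)ᶜ) ≤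
      ENNReal.ofReal (Fintype.card A * (2 * Real.exp (-γ ^ 2 / 2))) := by
  have hsub : Prod.mk h ⁻¹' (M.concentrated lam (γ * v) t)ᶜ ⊆
      ⋃ b ∈ (Finset.univ : Finset A), {θ | γ * Real.sqrt ((M.feat b).ofLp ⬝ᵥ
        (v ^ 2 • (M.gram lam h)⁻¹).mulVec (M.feat b).ofLp) <
          |inner ℝ (M.feat b) θ - inner ℝ (M.feat b) (M.estimate lam h)|} := by
    intro θ hθ
    simp only [concentrated, Set.mem_preimage, Set.mem_compl_iff, Set.mem_ofPred_eq, not_forall,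
      not_le] at hθ
    obtain ⟨b, hb⟩ := hθ
    simp only [Set.mem_iUnion, Set.mem_ofPred_eq]
    refine ⟨b, Finset.mem_univ b, ?_⟩
    rw [sqrt_cov_eq hv, ← mul_assoc]
    exact hb
  refine (measure_mono hsub).trans ((measure_biUnion_finset_le _ _).trans ?_)
  refine (Finset.sum_le_sum fun b _ => multivariateGaussian_concentration (M.estimate lam h)
    (M.feat b) (M.posSemidef_cov hlam v h) hγ).trans (le_of_eq ?_)
  rw [Finset.sum_const, nsmul_eq_mul, Finset.card_univ,
    ENNReal.ofReal_mul (p := (Fintype.card A : ℝ)) (by positivity),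
    ENNReal.ofReal_natCast]

omit [MeasurableSpace A] [MeasurableSingletonClass A] in
-- An upward deviation of 3/2 standard deviations, that is 3v/2 ≥ β widths, overcomes the estimation
-- error of the best arm. The probability of failed concentration is then subtracted.
theorem gaussian_optimistic_concentrated_ge (hlam : 0 < lam) {v γ β : ℝ} (hv : 0 ≤ v)
    (hγ : 0 ≤ γ) (hβ : β ≤ v * (3 / 2)) {t : ℕ} {h : Fin t → A × ℝ}
    (hh : h ∈ M.accurate lam α β t) {c : A} (hc : M.mean α c = M.maxMean α) :
    ENNReal.ofReal (Real.exp (-2) / Real.sqrt (2 * Real.pi) / 2 -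
        Fintype.card A * (2 * Real.exp (-γ ^ 2 / 2))) ≤
      multivariateGaussian (M.estimate lam h) (v ^ 2 • (M.gram lam h)⁻¹)
        (Prod.mk h ⁻¹' (M.concentrated lam (γ * v) t ∩ {p | M.maxMean α ≤ M.mean p.2 c})) := by
  set μ := multivariateGaussian (M.estimate lam h) (v ^ 2 • (M.gram lam h)⁻¹)
  have h1 : ENNReal.ofReal (Real.exp (-2) / Real.sqrt (2 * Real.pi) / 2) ≤
      μ {θ | M.maxMean α ≤ inner ℝ (M.feat c) θ} := by
    refine multivariateGaussian_anticoncentration _ _ (M.posSemidef_cov hlam v h) ?_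
    rw [sqrt_cov_eq hv, ← hc]
    have h2 := (abs_le.mp (hh c)).1
    have h3 := mul_le_mul_of_nonneg_right hβ (M.width_nonneg (lam := lam) h c)
    have h4 : inner ℝ (M.feat c) (M.estimate lam h) = M.mean (M.estimate lam h) c := rfl
    rw [h4]
    linarith
  have h2 := gaussian_not_concentrated_le (M := M) hlam hv hγ h
  have h3 : {θ | M.maxMean α ≤ inner ℝ (M.feat c) θ} ⊆
      (Prod.mk h ⁻¹' (M.concentrated lam (γ * v) t ∩ {p | M.maxMean α ≤ M.mean p.2 c})) ∪
      (Prod.mk h ⁻¹' (M.concentrated lam (γ * v) t)ᶜ) := by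
    intro θ hθ
    by_cases hm : (h, θ) ∈ M.concentrated lam (γ * v) t
    · exact Or.inl ⟨hm, hθ⟩
    · exact Or.inr hm
  rw [ENNReal.ofReal_sub _ (by positivity), tsub_le_iff_right]
  exact h1.trans ((measure_mono h3).trans ((measure_union_le _ _).trans (add_le_add_right h2 _)))

/-- One round of SpectralTS: tested against nonnegative functions of the history, the regret on
accurate histories is at most a multiple of the width of the played arm plus a small constant. -/
theorem integral_mul_regret_sub_width_le (hlam : 0 < lam) {v γ β D : ℝ} (hv : 0 ≤ v)
    (hγ : 0 ≤ γ) (hβ0 : 0 ≤ β) (hβ : β ≤ v * (3 / 2))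
    (hD : ∀ b, M.maxMean α - M.mean α b ≤ D)
    {q r : ℝ} (hr : 0 < r) (hq : Fintype.card A * (2 * Real.exp (-γ ^ 2 / 2)) ≤ q)
    (hqr : r + q ≤ Real.exp (-2) / Real.sqrt (2 * Real.pi) / 2)
    (hrun : IsSpectralTSRun M lam R v α T P αs a ε) {t : ℕ} (ht : t < T)
    {ψ : (Fin t → A × ℝ) → ℝ} (hψ : Measurable ψ) {K : ℝ}
    (hψ0 : ∀ ω, 0 ≤ ψ (M.history α a ε t ω)) (hψK : ∀ ω, ψ (M.history α a ε t ω) ≤ K) :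
    ∫ ω, ψ (M.history α a ε t ω) *
      ((M.accurate lam α β t).indicator 1 (M.history α a ε t ω) *
          (M.maxMean α - M.mean α (a t ω)) -
        (γ * v + β + 2 * (γ * v) / r) * M.width lam (M.history α a ε t ω) (a t ω) - D * q) ∂P
      ≤ 0 := by
  have hX : Measurable (M.history α a ε t) :=
    M.measurable_history α hrun.measurable_arm hrun.measurable_noise ht.le
  have hY := hrun.measurable_sample t ht
  have ha := hrun.measurable_arm t ht
  obtain ⟨c, -, hc⟩ := Finset.exists_mem_eq_sup' Finset.univ_nonempty (M.mean α)
  have hc' : M.mean α c = M.maxMean α := hc.symm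
  have hmax (b : A) : M.mean α b ≤ M.maxMean α := Finset.le_sup' _ (Finset.mem_univ b)
  have hD0 : 0 ≤ D := le_trans (by rw [hc', sub_self]) (hD c)
  have hq0 : 0 ≤ q := le_trans (by positivity) hq
  set H := M.history α a ε t with hH
  set G := M.accurate lam α β t with hG
  have hGm : MeasurableSet G := M.measurableSet_accurate lam α β t
  set w : Ω → ℝ := fun ω => M.width lam (H ω) (a t ω) with hw
  have hwm : Measurable w :=
    (measurable_from_prod_countable_left (f := fun p : (Fin t → A × ℝ) × A => M.width lam p.1 p.2)
      fun b => M.measurable_width lam b).comp (hX.prodMk ha)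
  have hw0 (ω : Ω) : 0 ≤ w ω := M.width_nonneg _ _
  have hw1 (ω : Ω) : w ω ≤ 1 / Real.sqrt lam := M.width_le hlam _ _
  have hK0 (ω : Ω) : 0 ≤ K := (hψ0 ω).trans (hψK ω)
  set C := M.concentrated lam (γ * v) t with hC
  have hCm : MeasurableSet C := M.measurableSet_concentrated lam (γ * v) t
  set O : Set ((Fin t → A × ℝ) × EuclideanSpace ℝ ι) := {p | M.maxMean α ≤ M.mean p.2 c} with hO
  have hOm : MeasurableSet O :=
    measurableSet_le measurable_const ((M.measurable_mean c).comp measurable_snd)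
  set gap : (Fin t → A × ℝ) → ℝ :=
    fun h => max (M.maxMean α - M.maxLower lam (γ * v) h) 0 with hgap
  -- The gap on accurate histories weighted by the test function: it depends on the history alone,
  -- so it can be pulled out of the conditional law of the sample.
  set φ : (Fin t → A × ℝ) → ℝ := fun h => ψ h * (G.indicator 1 h * gap h) with hφ
  have hφm : Measurable φ := hψ.mul ((measurable_one.indicator hGm).mul
    ((measurable_const.sub (M.measurable_maxLower lam (γ * v) t)).max measurable_const))
  have hgapG (h : Fin t → A × ℝ) : 0 ≤ G.indicator 1 h * gap h ∧
      G.indicator 1 h * gap h ≤ (γ * v + β) * (1 / Real.sqrt lam) := by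
    by_cases hm : h ∈ G
    · simp only [Set.indicator_of_mem hm, Pi.one_apply, one_mul]
      exact ⟨le_max_right _ _, gap_le_of_accurate hlam hβ0 (by positivity) hm⟩
    · simp only [Set.indicator_of_notMem hm, zero_mul]
      exact ⟨le_rfl, by positivity⟩
  have hφ0 (ω : Ω) : 0 ≤ φ (H ω) := mul_nonneg (hψ0 ω) (hgapG _).1
  have hφK (ω : Ω) : φ (H ω) ≤ K * ((γ * v + β) * (1 / Real.sqrt lam)) :=
    mul_le_mul (hψK ω) (hgapG _).2 (hgapG _).1 (hK0 ω)
  have hψi : Integrable (fun ω => ψ (H ω)) P :=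
    integrable_of_measurable_of_abs_le (hψ.comp hX) fun ω => by
      rw [abs_of_nonneg (hψ0 ω)]; exact hψK ω
  have hφi : Integrable (fun ω => φ (H ω)) P :=
    integrable_of_measurable_of_abs_le (hφm.comp hX) fun ω => by
      rw [abs_of_nonneg (hφ0 ω)]; exact hφK ω
  have hψwi : Integrable (fun ω => ψ (H ω) * w ω) P :=
    integrable_of_measurable_of_abs_le (K := K * (1 / Real.sqrt lam))
      ((hψ.comp hX).mul hwm) fun ω => by
        rw [abs_of_nonneg (mul_nonneg (hψ0 ω) (hw0 ω))]
        exact mul_le_mul (hψK ω) (hw1 ω) (hw0 ω) (hK0 ω)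
  have harg (ω : Ω) (b : A) : M.mean (αs t ω) b ≤ M.mean (αs t ω) (a t ω) :=
    hrun.arm_argmax t ht ω b
  have hlaw := hrun.sample_law t ht
  have step1 : r * ∫ ω, φ (H ω) ∂P ≤ 2 * (γ * v) * ∫ ω, ψ (H ω) * w ω ∂P := by
    have h1 := mul_integral_le_of_le_condDistrib P hX hY hφm hφ0 hφK (hCm.inter hOm) hr.le (by
      filter_upwards [hlaw] with ω hω hne
      have hmem : H ω ∈ G := by
        by_contra hn
        exact hne (by simp [hφ, Set.indicator_of_notMem hn])
      rw [hω]
      refine (ENNReal.ofReal_le_ofReal ?_).trans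
        (gaussian_optimistic_concentrated_ge hlam hv hγ hβ hmem hc')
      linarith)
    refine h1.trans ?_
    rw [← integral_const_mul]
    refine integral_mono (integrable_mul_indicator P hX hY hφm hφ0 hφK (hCm.inter hOm))
      (hψwi.const_mul _) fun ω => ?_
    have hrhs : 0 ≤ 2 * (γ * v) * (ψ (H ω) * w ω) :=
      mul_nonneg (by positivity) (mul_nonneg (hψ0 ω) (hw0 ω))
    by_cases hm : (H ω, αs t ω) ∈ C ∩ O
    · simp only [Set.indicator_of_mem hm, Pi.one_apply, mul_one, hφ]
      have h2 : gap (H ω) ≤ 2 * (γ * v) * w ω :=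
        max_le (gap_le_of_optimistic (harg ω) hm.1 hm.2)
          (mul_nonneg (by positivity) (hw0 ω))
      have h3 : G.indicator 1 (H ω) * gap (H ω) ≤ 2 * (γ * v) * w ω := by
        by_cases hg : H ω ∈ G
        · simpa only [Set.indicator_of_mem hg, Pi.one_apply, one_mul] using h2
        · simp only [Set.indicator_of_notMem hg, zero_mul]
          exact mul_nonneg (by positivity) (hw0 ω)
      have := mul_le_mul_of_nonneg_left h3 (hψ0 ω)
      linarith
    · simpa only [Set.indicator_of_notMem hm, mul_zero] using hrhs
  have step2 : ∫ ω, ψ (H ω) * Cᶜ.indicator 1 (H ω, αs t ω) ∂P ≤ q * ∫ ω, ψ (H ω) ∂P := by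
    refine integral_mul_indicator_le_of_condDistrib_le P hX hY hψ hψ0 hψK hCm.compl hq0 ?_
    filter_upwards [hlaw] with ω hω
    rw [hω]
    exact (gaussian_not_concentrated_le hlam hv hγ _).trans (ENNReal.ofReal_le_ofReal hq)
  have hCi := integrable_mul_indicator P hX hY hψ hψ0 hψK hCm.compl
  have hpt (ω : Ω) : ψ (H ω) * (G.indicator 1 (H ω) * (M.maxMean α - M.mean α (a t ω)) -
      (γ * v + β + 2 * (γ * v) / r) * w ω - D * q) ≤
      φ (H ω) - 2 * (γ * v) / r * (ψ (H ω) * w ω) +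
        D * (ψ (H ω) * Cᶜ.indicator 1 (H ω, αs t ω)) - D * q * ψ (H ω) := by
    -- On concentrated samples the gap bound applies; otherwise the regret is at most D, on an event
    -- of conditional probability at most q.
    have h1 : G.indicator 1 (H ω) * (M.maxMean α - M.mean α (a t ω)) ≤
        G.indicator 1 (H ω) * gap (H ω) + (γ * v + β) * w ω +
          D * Cᶜ.indicator 1 (H ω, αs t ω) := by
      have hw' : 0 ≤ (γ * v + β) * w ω := mul_nonneg (by positivity) (hw0 ω)
      have hi0 : 0 ≤ D * Cᶜ.indicator 1 (H ω, αs t ω) :=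
        mul_nonneg hD0 (Set.indicator_nonneg (fun _ _ => zero_le_one) _)
      by_cases hg : H ω ∈ G
      · simp only [Set.indicator_of_mem hg, Pi.one_apply, one_mul]
        by_cases hm : (H ω, αs t ω) ∈ C
        · have := regret_le_of_concentrated (harg ω) hg hm
          linarith
        · have hm' : (H ω, αs t ω) ∈ Cᶜ := hm
          simp only [Set.indicator_of_mem hm', Pi.one_apply, mul_one]
          have h2 : 0 ≤ gap (H ω) := le_max_right _ _
          linarith [hD (a t ω)]
      · simp only [Set.indicator_of_notMem hg, zero_mul, zero_add]
        linarith
    have h2 := mul_le_mul_of_nonneg_left h1 (hψ0 ω)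
    simp only [hφ]
    linarith
  have hΔm : Measurable fun ω => M.mean α (a t ω) :=
    (Measurable.of_discrete (f := M.mean α)).comp ha
  have hLm : Measurable fun ω => G.indicator 1 (H ω) * (M.maxMean α - M.mean α (a t ω)) -
      (γ * v + β + 2 * (γ * v) / r) * w ω - D * q :=
    ((((measurable_one.indicator hGm).comp hX).mul (measurable_const.sub hΔm)).sub
      (hwm.const_mul _)).sub_const _
  have hLi : Integrable (fun ω => ψ (H ω) * (G.indicator 1 (H ω) *
      (M.maxMean α - M.mean α (a t ω)) -
        (γ * v + β + 2 * (γ * v) / r) * w ω - D * q)) P := by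
    refine hψi.mul_bdd (c := D + (γ * v + β + 2 * (γ * v) / r) * (1 / Real.sqrt lam) + D * q)
      hLm.aestronglyMeasurable (Filter.Eventually.of_forall fun ω => ?_)
    have h1 : 0 ≤ G.indicator 1 (H ω) * (M.maxMean α - M.mean α (a t ω)) ∧
        G.indicator 1 (H ω) * (M.maxMean α - M.mean α (a t ω)) ≤ D := by
      by_cases hg : H ω ∈ G
      · simp only [Set.indicator_of_mem hg, Pi.one_apply, one_mul]
        exact ⟨sub_nonneg.mpr (hmax _), hD _⟩
      · simp only [Set.indicator_of_notMem hg, zero_mul]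
        exact ⟨le_rfl, hD0⟩
    have h2 : 0 ≤ γ * v + β + 2 * (γ * v) / r := by positivity
    have h3 := mul_le_mul_of_nonneg_left (hw1 ω) h2
    have h4 := mul_nonneg h2 (hw0 ω)
    have h5 : 0 ≤ D * q := by positivity
    rw [Real.norm_eq_abs, abs_le]
    constructor <;> linarith
  refine (integral_mono hLi (((hφi.sub (hψwi.const_mul _)).add (hCi.const_mul D)).sub
    (hψi.const_mul (D * q))) hpt).trans ?_
  rw [integral_sub' ((hφi.sub (hψwi.const_mul _)).add (hCi.const_mul D)) (hψi.const_mul (D * q)),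
    integral_add' (hφi.sub (hψwi.const_mul _)) (hCi.const_mul D),
    integral_sub' hφi (hψwi.const_mul _), integral_const_mul, integral_const_mul,
    integral_const_mul]
  have h1 : ∫ ω, φ (H ω) ∂P ≤ 2 * (γ * v) / r * ∫ ω, ψ (H ω) * w ω ∂P := by
    rw [div_mul_eq_mul_div, le_div_iff₀ hr]
    linarith
  have h2 := mul_le_mul_of_nonneg_left step2 hD0
  linarith

end Step

end SpectralBandit

/-! ### From single rounds to the total regret. -/

namespace SpectralBandit

section Regret

variable {A ι Ω : Type*} [Fintype ι] [DecidableEq ι] [Fintype A] [Nonempty A] [MeasurableSpace A]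
  [MeasurableSingletonClass A] [MeasurableSpace Ω] {P : Measure Ω}
  [IsProbabilityMeasure P] {M : SpectralBandit A ι} {lam R : ℝ} {α : EuclideanSpace ℝ ι}
  {T : ℕ} {αs : ℕ → Ω → EuclideanSpace ℝ ι} {a : ℕ → Ω → A} {ε : ℕ → Ω → ℝ}

omit [DecidableEq ι] [MeasurableSpace A] [MeasurableSingletonClass A] [MeasurableSpace Ω] in
theorem regret_eq_sum (ω : Ω) :
    M.regret α a T ω = ∑ t ∈ Finset.range T, (M.maxMean α - M.mean α (a t ω)) := by
  rw [Finset.sum_sub_distrib, Finset.sum_const, Finset.card_range, nsmul_eq_mul]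
  rfl

omit [DecidableEq ι] [MeasurableSpace A] [MeasurableSingletonClass A] in
theorem maxMean_sub_mean_le (hlam : 0 < lam) {C : ℝ} (hC : M.lamNorm lam α ≤ C) (b : A) :
    M.maxMean α - M.mean α b ≤ 2 * (C / Real.sqrt lam) := by
  have h (b : A) : |M.mean α b| ≤ C / Real.sqrt lam :=
    (M.abs_mean_le hlam α b).trans (div_le_div_of_nonneg_right hC (Real.sqrt_nonneg _))
  have h1 : M.maxMean α ≤ C / Real.sqrt lam :=
    Finset.sup'_le _ _ fun b _ => (abs_le.mp (h b)).2
  linarith [(abs_le.mp (h b)).1]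

omit [Fintype A] [Nonempty A] [MeasurableSpace A] [MeasurableSingletonClass A] in
theorem mem_accurate_of_noiseNormSq_le (hlam : 0 < lam) {C : ℝ} (hC : M.lamNorm lam α ≤ C)
    {ρ Q : ℝ} (hρ : 0 ≤ ρ) {t : ℕ} {h : Fin t → A × ℝ} (hh : M.noiseNormSq lam α h ≤ ρ ^ 2 * Q) :
    h ∈ M.accurate lam α (ρ * Real.sqrt Q + C) t := by
  intro b
  refine (M.abs_mean_estimate_sub_le hlam α h b).trans ?_
  rw [mul_comm]
  refine mul_le_mul_of_nonneg_right (add_le_add ?_ hC) (M.width_nonneg h b)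
  refine (Real.sqrt_le_sqrt hh).trans (le_of_eq ?_)
  rw [Real.sqrt_mul (sq_nonneg ρ), Real.sqrt_sq hρ]

omit [Fintype A] [Nonempty A] [MeasurableSpace A] [MeasurableSingletonClass A]
  [MeasurableSpace Ω] in
theorem sum_width_le (hlam : 0 < lam) (hT : 1 ≤ T) (ω : Ω) :
    ∑ t ∈ Finset.range T, M.width lam (M.history α a ε t ω) (a t ω) ≤
      Real.sqrt ((1 + 1 / lam) * M.effDim lam T * T *
        Real.log (1 + T / (M.zeroMult * lam))) := by
  refine Real.le_sqrt_of_sq_le ?_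
  have h1 := sq_sum_le_card_mul_sum_sq (s := Finset.range T)
    (f := fun t => M.width lam (M.history α a ε t ω) (a t ω))
  rw [Finset.card_range] at h1
  have h2 := mul_le_mul_of_nonneg_left (M.sum_width_sq_le hlam α a ε hT ω) (Nat.cast_nonneg T)
  linarith

/-- The regret bound of SpectralTS with free parameters. -/
theorem regret_le_of_parameters (hlam : 0 < lam) (hR : 0 ≤ R) (hT : 1 ≤ T) {C : ℝ}
    (hC : M.lamNorm lam α ≤ C) {v γ β D b : ℝ} (hv : 0 ≤ v) (hγ : 0 ≤ γ)
    {δ : ℝ} (hδ : 0 < δ) (hδ1 : δ < 1) {ρ : ℝ} (hρ : 0 < ρ) (hRρ : R ≤ ρ)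
    (hβdef : ρ * Real.sqrt (2 * Real.log (1 / δ) +
      M.effDim lam T * Real.log (1 + T / (M.zeroMult * lam))) + C = β)
    (hβ : β ≤ v * (3 / 2)) (hD : ∀ b, M.maxMean α - M.mean α b ≤ D)
    {q r : ℝ} (hr : 0 < r) (hq : Fintype.card A * (2 * Real.exp (-γ ^ 2 / 2)) ≤ q)
    (hqr : r + q ≤ Real.exp (-2) / Real.sqrt (2 * Real.pi) / 2) (hb0 : 0 < b) (hDb : D ≤ b)
    (hb : (γ * v + β + 2 * (γ * v) / r) * (1 / Real.sqrt lam) + D * q ≤ b)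
    (hrun : IsSpectralTSRun M lam R v α T P αs a ε) :
    1 - 2 * δ ≤ P.real {ω | M.regret α a T ω ≤
      b * Real.sqrt (2 * T * Real.log (1 / δ)) +
      (γ * v + β + 2 * (γ * v) / r) * Real.sqrt ((1 + 1 / lam) * M.effDim lam T * T *
        Real.log (1 + T / (M.zeroMult * lam))) + T * (D * q)} := by
  have hC0 : 0 ≤ C := (Real.sqrt_nonneg _).trans hC
  have hβ0 : 0 ≤ β := by rw [← hβdef]; positivity
  have hc0 : 0 ≤ γ * v + β + 2 * (γ * v) / r := by positivity
  set c := γ * v + β + 2 * (γ * v) / r with hc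
  have hmax (b : A) : M.mean α b ≤ M.maxMean α := Finset.le_sup' _ (Finset.mem_univ b)
  have hD0 : 0 ≤ D := le_trans (sub_nonneg.mpr (hmax (Classical.arbitrary A))) (hD _)
  have hq0 : 0 ≤ q := le_trans (by positivity) hq
  have hDq : 0 ≤ D * q := by positivity
  have hH (t : ℕ) (ht : t ≤ T) : Measurable (M.history α a ε t) :=
    M.measurable_history α hrun.measurable_arm hrun.measurable_noise ht
  set W : ℕ → Ω → ℝ := fun t ω =>
    (M.accurate lam α β t).indicator 1 (M.history α a ε t ω) *
          (M.maxMean α - M.mean α (a t ω)) -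
        c * M.width lam (M.history α a ε t ω) (a t ω) - D * q with hW
  have hazuma := measureReal_sum_ge_le_of_bounded P hT (W := W)
    (ℱ := fun t => MeasurableSpace.comap (M.history α a ε t) inferInstance)
    (fun t ht => (hH t ht).comap_le) (fun t _ => M.comap_history_mono α a ε t.le_succ)
    (by
      intro t ht
      have h1 : Measurable[MeasurableSpace.comap (M.history α a ε (t + 1)) inferInstance]
          (M.history α a ε t) := by
        rw [measurable_iff_comap_le]
        exact M.comap_history_mono α a ε t.le_succ
      have h2 : Measurable[MeasurableSpace.comap (M.history α a ε (t + 1)) inferInstance]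
          (a t) :=
        ((measurable_fst.comp (measurable_pi_apply (Fin.last t))).comp
          (comap_measurable (M.history α a ε (t + 1))) :)
      refine Measurable.sub_const (Measurable.sub (Measurable.mul ?_ ?_)
        (Measurable.const_mul ?_ _)) _
      · exact (measurable_one.indicator (M.measurableSet_accurate lam α β t)).comp h1
      · exact measurable_const.sub ((Measurable.of_discrete (f := M.mean α)).comp h2)
      · exact (measurable_from_prod_countable_left
          (f := fun p : (Fin t → A × ℝ) × A => M.width lam p.1 p.2)
          fun b => M.measurable_width lam b).comp (h1.prodMk h2))
    hb0
    (by
      intro t _ ω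
      have h1 := mul_le_mul_of_nonneg_left (M.width_le hlam (M.history α a ε t ω) (a t ω)) hc0
      have h2 := mul_nonneg hc0 (M.width_nonneg (lam := lam) (M.history α a ε t ω) (a t ω))
      have h3 : 0 ≤ (M.accurate lam α β t).indicator 1 (M.history α a ε t ω) *
            (M.maxMean α - M.mean α (a t ω)) ∧
          (M.accurate lam α β t).indicator 1 (M.history α a ε t ω) *
            (M.maxMean α - M.mean α (a t ω)) ≤ D := by
        by_cases hg : M.history α a ε t ω ∈ M.accurate lam α β t
        · simp only [Set.indicator_of_mem hg, Pi.one_apply, one_mul]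
          exact ⟨sub_nonneg.mpr (hmax _), hD _⟩
        · simp only [Set.indicator_of_notMem hg, zero_mul]
          exact ⟨le_rfl, hD0⟩
      rw [abs_le]
      simp only [hW]
      constructor <;> linarith)
    (by
      rintro t ht ψ hψ hψ0 ⟨K, hK⟩
      -- A test function measurable with respect to the history factors through it (Doob–Dynkin), so
      -- the one-round bound applies.
      obtain ⟨ψ', hψ', rfl⟩ := hψ.exists_eq_measurable_comp
      exact integral_mul_regret_sub_width_le hlam hv hγ hβ0 hβ hD hr hq hqr hrun ht hψ' hψ0 hK)
    hδ hδ1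
  have hconf := measure_exists_noiseNormSq_gt_le hlam hrun hR hρ hRρ hT hδ
  set Q := 2 * Real.log (1 / δ) + M.effDim lam T * Real.log (1 + T / (M.zeroMult * lam)) with hQ
  set E₁ := {ω | ∃ t ≤ T, ρ ^ 2 * Q < M.noiseNormSq lam α (M.history α a ε t ω)} with hE₁
  set E₂ := {ω | b * Real.sqrt (2 * T * Real.log (1 / δ)) ≤ ∑ n ∈ Finset.range T, W n ω} with hE₂
  set S := {ω | M.regret α a T ω ≤
      b * Real.sqrt (2 * T * Real.log (1 / δ)) +
      c * Real.sqrt ((1 + 1 / lam) * M.effDim lam T * T *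
        Real.log (1 + T / (M.zeroMult * lam))) + T * (D * q)} with hS
  have hconf' : P.real E₁ ≤ δ := ENNReal.toReal_le_of_le_ofReal hδ.le hconf
  -- Outside the failure of confidence and the Azuma deviation, all histories are accurate, and the
  -- indicators in W are one.
  have hcover : Set.univ ⊆ S ∪ (E₁ ∪ E₂) := by
    intro ω _
    by_contra hω
    simp only [Set.mem_union, not_or] at hω
    obtain ⟨h1, h2, h3⟩ := hω
    apply h1
    simp only [hE₁, hE₂, Set.mem_ofPred_eq, not_exists, not_and, not_lt, not_le] at h2 h3
    simp only [hS, Set.mem_ofPred_eq]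
    have h4 : M.regret α a T ω = ∑ t ∈ Finset.range T, W t ω +
        c * ∑ t ∈ Finset.range T, M.width lam (M.history α a ε t ω) (a t ω) + T * (D * q) := by
      rw [regret_eq_sum, Finset.mul_sum, ← Finset.sum_add_distrib, ← nsmul_eq_mul,
        ← Finset.card_range T, ← Finset.sum_const, Finset.card_range, ← Finset.sum_add_distrib]
      refine Finset.sum_congr rfl fun t ht => ?_
      have hmem : M.history α a ε t ω ∈ M.accurate lam α β t := by
        rw [← hβdef]
        exact mem_accurate_of_noiseNormSq_le hlam hC hρ.le (h2 t (Finset.mem_range.mp ht).le)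
      simp only [hW, Set.indicator_of_mem hmem, Pi.one_apply]
      ring
    rw [h4]
    have h5 := mul_le_mul_of_nonneg_left (sum_width_le (M := M) (α := α) (a := a) (ε := ε)
      hlam hT ω) hc0
    linarith
  have h1 : P.real Set.univ ≤ P.real S + (P.real E₁ + P.real E₂) :=
    (measureReal_mono hcover).trans ((measureReal_union_le _ _).trans
      (add_le_add le_rfl (measureReal_union_le _ _)))
  rw [probReal_univ] at h1
  linarith

end Regret

end SpectralBandit

/-! ### Numerical constants. -/

section Constants

theorem nineteen_le_one_div_tsP : 19 ≤ 1 / tsP := by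
  rw [tsP, one_div_one_div]
  have h1 : (2.7182818283 : ℝ) < Real.exp 1 := Real.exp_one_gt_d9
  have h2 : (1.77 : ℝ) ≤ Real.sqrt Real.pi := by
    refine Real.le_sqrt_of_sq_le ?_
    have := Real.pi_gt_d2
    norm_num at this ⊢
    linarith
  nlinarith

/-- The right side is about 0.027. The split reserves r = 1/50 for optimism and 1/1000 for failed
concentration. -/
theorem anticoncentration_constant_ge :
    1 / 50 + 1 / 1000 ≤ Real.exp (-2) / Real.sqrt (2 * Real.pi) / 2 := by
  have h1 : Real.exp 1 < 2.7182818286 := Real.exp_one_lt_d9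
  have h2 : Real.exp 2 ≤ 7.4 := by
    have : Real.exp 2 = Real.exp 1 * Real.exp 1 := by rw [← Real.exp_add]; norm_num
    rw [this]
    nlinarith [Real.exp_pos 1]
  have h3 : Real.sqrt (2 * Real.pi) ≤ 2.51 := by
    rw [Real.sqrt_le_left (by norm_num)]
    have := Real.pi_lt_d2
    norm_num at this ⊢
    linarith
  have h4 : 0 < Real.sqrt (2 * Real.pi) := by positivity
  rw [Real.exp_neg, div_div, inv_eq_one_div, div_div, le_div_iff₀ (by positivity)]
  have h5 : Real.exp 2 * (Real.sqrt (2 * Real.pi) * 2) ≤ 7.4 * (2.51 * 2) := by gcongr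
  linarith

/-- Only the terms with factor 11 are kept, and 209 = 11 · 19. -/
theorem tsBound_ge {lam R C δ g : ℝ} {T d K N : ℕ} (hg0 : 0 ≤ g)
    (hg : g ≤ tsG lam R C δ T d K N) :
    209 * g * Real.sqrt ((2 + 2 * lam) / lam * d * T * Real.log (1 + T / (K * lam))) +
      209 * (g / Real.sqrt lam) * Real.sqrt (2 * T * Real.log (2 / δ)) ≤
      tsBound lam R C δ T d K N := by
  have hp := nineteen_le_one_div_tsP
  have h1 : 19 * g ≤ tsG lam R C δ T d K N / tsP := by
    rw [div_eq_mul_one_div, mul_comm 19]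
    exact mul_le_mul hg hp (by norm_num) (hg0.trans hg)
  set X := Real.sqrt ((2 + 2 * lam) / lam * d * T * Real.log (1 + T / (K * lam))) with hX
  set Y := Real.sqrt (2 * T * Real.log (2 / δ)) with hY
  have hX0 : 0 ≤ X := Real.sqrt_nonneg _
  have hY0 : 0 ≤ Y := Real.sqrt_nonneg _
  have hs : 0 ≤ 1 / Real.sqrt lam := by positivity
  have e1 : 209 * g * X ≤ 11 * tsG lam R C δ T d K N / tsP * X := by
    rw [mul_div_assoc]
    exact mul_le_mul_of_nonneg_right (by linarith) hX0
  have e2 : 209 * (g / Real.sqrt lam) * Y ≤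
      tsG lam R C δ T d K N / tsP * (11 / Real.sqrt lam + 2) * Y := by
    refine mul_le_mul_of_nonneg_right ?_ hY0
    have h2 : 0 ≤ tsG lam R C δ T d K N / tsP := by linarith
    calc 209 * (g / Real.sqrt lam) = 19 * g * (11 * (1 / Real.sqrt lam)) := by ring
      _ ≤ tsG lam R C δ T d K N / tsP * (11 * (1 / Real.sqrt lam)) :=
          mul_le_mul_of_nonneg_right h1 (by positivity)
      _ ≤ _ := by
          refine mul_le_mul_of_nonneg_left ?_ h2
          rw [mul_one_div]
          linarith
  have e3 : (0 : ℝ) ≤ 1 / T := by positivity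
  rw [tsBound]
  linarith

end Constants

theorem exp_nine_le : Real.exp 9 ≤ 20000 := by
  have h1 : Real.exp 1 < 2.7182818286 := Real.exp_one_lt_d9
  have h2 : Real.exp 9 = Real.exp 1 ^ 9 := by rw [← Real.exp_nat_mul]; norm_num
  rw [h2]
  calc Real.exp 1 ^ 9 ≤ 2.7182818286 ^ 9 := by gcongr
    _ ≤ 20000 := by norm_num

theorem nine_le_log_one_add {x : ℝ} (hx : 0 < x) (h : 20000 * Real.log (1 + x) < x) :
    9 ≤ Real.log (1 + x) := by
  have h1 : 1 - (1 + x)⁻¹ ≤ Real.log (1 + x) := Real.one_sub_inv_le_log_of_pos (by linarith)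
  have h2 : 1 - (1 + x)⁻¹ = x / (1 + x) := by field_simp; ring
  rw [h2, div_le_iff₀ (by linarith)] at h1
  have h3 : 20000 ≤ 1 + x := by nlinarith
  rw [Real.le_log_iff_exp_le (by linarith)]
  exact exp_nine_le.trans h3

theorem log_inv_add_div_eq {δ lam : ℝ} (hδ : 0 < δ) (hlam : 0 < lam) {T K : ℝ} (hT : 0 ≤ T)
    (hK : 0 < K) :
    Real.log (1 / δ + T / (δ * lam * K)) = Real.log (1 / δ) + Real.log (1 + T / (K * lam)) := by
  have h1 : 0 < 1 + T / (K * lam) := by positivity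
  rw [← Real.log_mul (by positivity) h1.ne']
  congr 1
  field_simp

/-- This choice of γ makes the Gaussian tail (TN)⁻², which pays for the union over N arms and leaves
order T⁻². -/
theorem card_mul_exp_neg_le {T N γ : ℝ} (hT : 1 ≤ T) (hN : 1 ≤ N)
    (hγ : γ ^ 2 = 4 * Real.log (T * N)) :
    N * (2 * Real.exp (-γ ^ 2 / 2)) ≤ 2 / T ^ 2 := by
  have h1 : -γ ^ 2 / 2 = Real.log (((T * N) ^ 2)⁻¹) := by
    rw [hγ, Real.log_inv, Real.log_pow]
    push_cast
    ring
  rw [h1, Real.exp_log (by positivity), mul_pow, mul_inv, le_div_iff₀ (by positivity)]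
  have h2 : N * (2 * ((T ^ 2)⁻¹ * (N ^ 2)⁻¹)) * T ^ 2 = 2 / N := by
    field_simp
  rw [h2, div_le_iff₀ (by linarith)]
  linarith

/-- Optimism tolerates β ≤ 3v/2. The spare C/2 pays for enlarging R to a strictly positive scale,
which is needed when R = 0. -/
theorem exists_noise_scale {R C Q Q' : ℝ} (hR : 0 ≤ R) (hC : 0 < C) (hQ : Q ≤ Q') :
    ∃ ρ, 0 < ρ ∧ R ≤ ρ ∧ ρ * Real.sqrt Q + C ≤ (R * Real.sqrt Q' + C) * (3 / 2) := by
  have hQs : 0 ≤ Real.sqrt Q := Real.sqrt_nonneg _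
  have hpos : 0 < C / (2 * (1 + Real.sqrt Q)) := by positivity
  refine ⟨R + C / (2 * (1 + Real.sqrt Q)), by linarith, by linarith, ?_⟩
  have h1 : R * Real.sqrt Q ≤ R * Real.sqrt Q' :=
    mul_le_mul_of_nonneg_left (Real.sqrt_le_sqrt hQ) hR
  have h2 : C / (2 * (1 + Real.sqrt Q)) * Real.sqrt Q ≤ C / 2 := by
    rw [div_mul_eq_mul_div, div_le_div_iff₀ (by positivity) (by norm_num)]
    nlinarith
  have h3 : 0 ≤ R * Real.sqrt Q' := by positivity
  rw [add_mul]
  linarith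

theorem two_div_sq_le {T : ℝ} (hT : 20000 ≤ T) : 2 / T ^ 2 ≤ 1 / 1000 := by
  rw [div_le_div_iff₀ (by positivity) (by norm_num)]
  nlinarith

theorem two_mul_log_add_le {l d L : ℝ} (hl : 0 ≤ l) (hd : 1 ≤ d) (hL : 9 ≤ L) :
    2 * (Real.log 2 + l) + d * L ≤ 3 * d * (l + L) := by
  have := Real.log_two_lt_d9
  have h1 : 1 * l ≤ d * l := mul_le_mul_of_nonneg_right hd hl
  have h2 : 1 * 9 ≤ d * L := mul_le_mul hd hL (by norm_num) (by linarith)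
  linarith

theorem tsG_ge {lam R C δ : ℝ} (hR : 0 ≤ R) (T d K N : ℕ) :
    Real.sqrt (4 * Real.log (T * N)) * tsScale lam R C δ T d K + C ≤ tsG lam R C δ T d K N := by
  have : 0 ≤ R * Real.sqrt (d * Real.log ((T : ℝ) ^ 2 / δ + (T : ℝ) ^ 3 / (δ * lam * K))) := by
    positivity
  rw [tsG, tsScale]
  linarith

theorem le_tsScale {lam R C δ : ℝ} (hR : 0 ≤ R) (T d K : ℕ) : C ≤ tsScale lam R C δ T d K := by
  rw [tsScale]
  have : 0 ≤ R * Real.sqrt (3 * d * Real.log (1 / δ + T / (δ * lam * K))) := by positivity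
  linarith

/-! ### Choice of parameters and the high-probability bound. -/

namespace SpectralBandit

variable {A ι Ω : Type*} [Fintype ι] [DecidableEq ι] [Fintype A] [Nonempty A] [MeasurableSpace A]
  [MeasurableSingletonClass A] [MeasurableSpace Ω] {P : Measure Ω}
  [IsProbabilityMeasure P] {M : SpectralBandit A ι} {lam R : ℝ} {α : EuclideanSpace ℝ ι}
  {T : ℕ} {αs : ℕ → Ω → EuclideanSpace ℝ ι} {a : ℕ → Ω → A} {ε : ℕ → Ω → ℝ}

omit [DecidableEq ι] [MeasurableSpace A] [MeasurableSingletonClass A] [MeasurableSpace Ω] in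
/-- The regret bound holds surely when the horizon is short or the parameter vanishes. -/
theorem regret_le_tsBound_of_short (hlam : 0 < lam) (hR : 0 ≤ R) {C δ : ℝ}
    (hC : M.lamNorm lam α ≤ C)
    (h : C = 0 ∨ (T : ℝ) ≤ 20000 * (1 + lam) * (M.effDim lam T *
      Real.log (1 + T / (M.zeroMult * lam)))) (ω : Ω) :
    M.regret α a T ω ≤
      tsBound lam R C δ T (M.effDim lam T) M.zeroMult (Fintype.card A) := by
  have hC0 : 0 ≤ C := (Real.sqrt_nonneg _).trans hC
  have hs : 0 < Real.sqrt lam := Real.sqrt_pos.mpr hlam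
  have hv := le_tsScale (lam := lam) (C := C) (δ := δ) hR T (M.effDim lam T) M.zeroMult
  have hg := tsG_ge (lam := lam) (C := C) (δ := δ) hR T (M.effDim lam T) M.zeroMult
    (Fintype.card A)
  have hg' : C ≤ tsG lam R C δ T (M.effDim lam T) M.zeroMult (Fintype.card A) := by
    have := mul_nonneg (Real.sqrt_nonneg (4 * Real.log (T * (Fintype.card A : ℕ)))) (hC0.trans hv)
    linarith
  refine le_trans ?_ (tsBound_ge hC0 hg')
  have h1 : M.regret α a T ω ≤ T * (2 * (C / Real.sqrt lam)) := by
    rw [regret_eq_sum]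
    refine (Finset.sum_le_sum fun t _ => maxMean_sub_mean_le hlam hC (a t ω)).trans ?_
    simp
  have h2 : 0 ≤ 209 * (C / Real.sqrt lam) * Real.sqrt (2 * T * Real.log (2 / δ)) := by positivity
  suffices h3 : T * (2 * (C / Real.sqrt lam)) ≤ 209 * C * Real.sqrt ((2 + 2 * lam) / lam *
      M.effDim lam T * T * Real.log (1 + T / (M.zeroMult * lam))) by linarith
  rcases h with h | h
  · simp [h]
  -- Squaring, this needs T ≤ (209²/2)(1 + λ)dL, and 209²/2 exceeds 20000.
  · have h4 : 2 * T / (209 * Real.sqrt lam) ≤ Real.sqrt ((2 + 2 * lam) / lam *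
        M.effDim lam T * T * Real.log (1 + T / (M.zeroMult * lam))) := by
      refine Real.le_sqrt_of_sq_le ?_
      rw [div_pow, mul_pow 209, Real.sq_sqrt hlam.le]
      have e : (2 + 2 * lam) / lam * M.effDim lam T * T *
          Real.log (1 + T / (M.zeroMult * lam)) = T * (2 * (1 + lam) * (M.effDim lam T *
            Real.log (1 + T / (M.zeroMult * lam)))) / lam := by
        field_simp
      rw [e, ← div_div, div_le_div_iff_of_pos_right hlam]
      have hT0 : (0 : ℝ) ≤ T := Nat.cast_nonneg T
      have := mul_le_mul_of_nonneg_left h hT0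
      rw [div_le_iff₀ (by norm_num)]
      nlinarith
    calc T * (2 * (C / Real.sqrt lam)) = 209 * C * (2 * T / (209 * Real.sqrt lam)) := by
          field_simp
      _ ≤ _ := mul_le_mul_of_nonneg_left h4 (by positivity)

set_option maxHeartbeats 1000000 in
/-- The high-probability regret bound of SpectralTS. -/
theorem one_sub_le_measure_regret_le_tsBound (hlam : 0 < lam) (hR : 0 ≤ R) {C δ : ℝ}
    (hδ : 0 < δ) (hδ1 : δ < 1) (hT : 1 ≤ T) (hC : M.lamNorm lam α ≤ C)
    (hrun : IsSpectralTSRun M lam R (tsScale lam R C δ T (M.effDim lam T) M.zeroMult) α T P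
      αs a ε) :
    1 - δ ≤ P.real {ω | M.regret α a T ω ≤
      tsBound lam R C δ T (M.effDim lam T) M.zeroMult (Fintype.card A)} := by
  by_cases hcase : C = 0 ∨ (T : ℝ) ≤ 20000 * (1 + lam) * (M.effDim lam T *
      Real.log (1 + T / (M.zeroMult * lam)))
  · have : {ω | M.regret α a T ω ≤
        tsBound lam R C δ T (M.effDim lam T) M.zeroMult (Fintype.card A)} = Set.univ :=
      Set.eq_univ_of_forall fun ω => regret_le_tsBound_of_short hlam hR hC hcase ω
    rw [this, probReal_univ]
    linarith
  push Not at hcase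
  obtain ⟨hCne, hlong⟩ := hcase
  have hC0 : 0 < C := lt_of_le_of_ne ((Real.sqrt_nonneg _).trans hC) hCne.symm
  have hs : 0 < Real.sqrt lam := Real.sqrt_pos.mpr hlam
  have hK : (1 : ℝ) ≤ M.zeroMult := by exact_mod_cast M.one_le_zeroMult
  have hKd : (M.zeroMult : ℝ) ≤ M.effDim lam T := by
    exact_mod_cast M.zeroMult_le_effDim hlam hT
  have hT1 : (1 : ℝ) ≤ T := by exact_mod_cast hT
  have hlogeq := log_inv_add_div_eq hδ hlam (zero_le_one.trans hT1) (zero_lt_one.trans_le hK)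
  have hg := tsG_ge (lam := lam) (C := C) (δ := δ) hR T (M.effDim lam T) M.zeroMult
    (Fintype.card A)
  have hCv := le_tsScale (lam := lam) (C := C) (δ := δ) hR T (M.effDim lam T) M.zeroMult
  have hvdef : tsScale lam R C δ T (M.effDim lam T) M.zeroMult =
    R * Real.sqrt (3 * M.effDim lam T * Real.log (1 / δ + T / (δ * lam * M.zeroMult))) + C := rfl
  rw [hlogeq] at hvdef
  have hL0 := M.log_pos_of_one_le hlam hT
  set v := tsScale lam R C δ T (M.effDim lam T) M.zeroMult with hv
  set d : ℝ := ((M.effDim lam T : ℕ) : ℝ) with hd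
  set L := Real.log (1 + T / (M.zeroMult * lam)) with hL
  have hd1 : 1 ≤ d := hK.trans hKd
  have hdL : L ≤ d * L := by nlinarith
  -- Since K ≤ d, the long horizon gives T/(Kλ) > 20000 L; as L is at least x/(1+x) at x = T/(Kλ),
  -- this forces 1 + x > 20000 ≥ e⁹.
  have hL9 : 9 ≤ L := by
    refine nine_le_log_one_add (by positivity) ?_
    rw [lt_div_iff₀ (by positivity)]
    refine lt_of_le_of_lt ?_ hlong
    have h1 : M.zeroMult * L ≤ d * L := mul_le_mul_of_nonneg_right hKd hL0.le
    have h2 : 0 ≤ d * L := by positivity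
    nlinarith [mul_le_mul_of_nonneg_left h1 hlam.le]
  have hTbig : (20000 : ℝ) ≤ T := by nlinarith [mul_nonneg hlam.le (hL0.le.trans hdL)]
  have hN : (1 : ℝ) ≤ Fintype.card A := by exact_mod_cast Fintype.card_pos
  have hTN : (20000 : ℝ) ≤ T * (Fintype.card A : ℕ) := by nlinarith
  have hlogTN : 9 ≤ Real.log (T * (Fintype.card A : ℕ)) := by
    rw [Real.le_log_iff_exp_le (by linarith)]
    exact exp_nine_le.trans hTN
  set γ := Real.sqrt (4 * Real.log (T * (Fintype.card A : ℕ))) with hγ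
  have hγsq : γ ^ 2 = 4 * Real.log (T * (Fintype.card A : ℕ)) :=
    Real.sq_sqrt (by linarith)
  have hγ6 : 6 ≤ γ := Real.le_sqrt_of_sq_le (by linarith)
  have hv0 : 0 < v := hC0.trans_le hCv
  have hγv : 6 * v ≤ γ * v := mul_le_mul_of_nonneg_right hγ6 hv0.le
  have hlogδ : 0 < Real.log (1 / δ) := Real.log_pos (by rw [lt_div_iff₀ hδ]; linarith)
  have hlog2 : Real.log (1 / (δ / 2)) = Real.log 2 + Real.log (1 / δ) := by
    rw [← Real.log_mul (by norm_num) (by positivity)]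
    congr 1
    field_simp
  have hl2' := Real.log_two_gt_d9
  obtain ⟨ρ, hρ0, hRρ, hβ⟩ := exists_noise_scale hR hC0
    (Q := 2 * Real.log (1 / (δ / 2)) + d * L) (Q' := 3 * d * (Real.log (1 / δ) + L))
    (by rw [hlog2]; exact two_mul_log_add_le hlogδ.le hd1 hL9)
  rw [← hvdef] at hβ
  obtain ⟨β, hβdef⟩ : ∃ β, ρ * Real.sqrt (2 * Real.log (1 / (δ / 2)) + d * L) + C = β := ⟨_, rfl⟩
  rw [hβdef] at hβ
  have hq := card_mul_exp_neg_le hT1 hN hγsq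
  have hq1 := two_div_sq_le hTbig
  have hCs : 0 ≤ C / Real.sqrt lam := by positivity
  have hCG : C / Real.sqrt lam ≤ γ * v / Real.sqrt lam :=
    div_le_div_of_nonneg_right (by linarith) hs.le
  -- Here γ ≥ 6 gives β ≤ 3v/2 ≤ γv/4, so 1 + 1/4 + 100 ≤ 102.
  have hc : γ * v + β + 2 * (γ * v) / (1 / 50) ≤ 102 * (γ * v) := by
    have : 2 * (γ * v) / (1 / 50) = 100 * (γ * v) := by ring
    linarith
  -- The confidence and Azuma failures each receive δ/2. The increment bound 103 is 102 from the
  -- widths plus room for Dq.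
  have hmain := regret_le_of_parameters (M := M) (P := P) (T := T) (αs := αs) (a := a) (ε := ε)
    (δ := δ / 2) (γ := γ) (v := v) (D := 2 * (C / Real.sqrt lam)) (q := 2 / (T : ℝ) ^ 2)
    (r := 1 / 50) (b := 103 * (γ * v / Real.sqrt lam)) hlam hR hT hC hv0.le (by linarith)
    (by linarith) (by linarith) hρ0 hRρ hβdef hβ (maxMean_sub_mean_le hlam hC) (by norm_num) hq
    ((add_le_add le_rfl hq1).trans anticoncentration_constant_ge)
    (by positivity) (by linarith) (by
      have h1 := mul_le_mul_of_nonneg_right hc (one_div_pos.mpr hs).le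
      have h2 : 102 * (γ * v) * (1 / Real.sqrt lam) = 102 * (γ * v / Real.sqrt lam) := by ring
      have h3 := mul_le_mul_of_nonneg_left hq1 (mul_nonneg zero_le_two hCs)
      linarith) hrun
  rw [mul_div_cancel₀ _ two_ne_zero] at hmain
  refine hmain.trans (measureReal_mono fun ω hω => ?_)
  simp only [Set.mem_ofPred_eq] at hω ⊢
  refine hω.trans (le_trans ?_ (tsBound_ge (g := γ * v) (by linarith) (by linarith)))
  rw [one_div_div]
  set Y := Real.sqrt (2 * T * Real.log (2 / δ)) with hY
  have hY1 : 1 ≤ Y := by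
    refine Real.le_sqrt_of_sq_le ?_
    rw [one_div_div] at hlog2
    rw [hlog2]
    nlinarith
  have hX : Real.sqrt ((1 + 1 / lam) * d * T * L) ≤
      Real.sqrt ((2 + 2 * lam) / lam * d * T * L) := by
    refine Real.sqrt_le_sqrt ?_
    have h1 : 1 + 1 / lam ≤ (2 + 2 * lam) / lam := by
      rw [le_div_iff₀ hlam, add_mul, one_div_mul_cancel hlam.ne']
      linarith
    gcongr
  have h1 : (γ * v + β + 2 * (γ * v) / (1 / 50)) *
      Real.sqrt ((1 + 1 / lam) * d * T * L) ≤
      209 * (γ * v) * Real.sqrt ((2 + 2 * lam) / lam * d * T * L) :=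
    mul_le_mul (hc.trans (by linarith)) hX (Real.sqrt_nonneg _) (by linarith)
  -- The accumulated concentration failures are of order 1/T and join the Azuma term: 103 + 4 ≤ 209.
  have h2 : T * (2 * (C / Real.sqrt lam) * (2 / (T : ℝ) ^ 2)) ≤
      4 * (γ * v / Real.sqrt lam) * Y := by
    have e : T * (2 * (C / Real.sqrt lam) * (2 / (T : ℝ) ^ 2)) =
        4 * (C / Real.sqrt lam) * (1 / T) := by
      field_simp
      ring
    rw [e]
    have h3 : 1 / (T : ℝ) ≤ Y := ((div_le_one (by linarith)).mpr hT1).trans hY1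
    exact mul_le_mul (by linarith) h3 (by positivity) (by linarith)
  have h3 : 0 ≤ γ * v / Real.sqrt lam * Y := mul_nonneg (by linarith) (by linarith)
  linarith

end SpectralBandit

/-! ### Order of growth of the bound. -/

/-- One has 1 + T/(Kλ) ≤ (1 + 1/λ)(1 + T), and the constant log (1 + 1/λ) is absorbed because log (1
+ T) ≥ log 2 > 1/2. -/
theorem log_one_add_div_le {lam T K : ℝ} (hlam : 0 < lam) (hT : 1 ≤ T) (hK : 1 ≤ K) :
    Real.log (1 + T / (K * lam)) ≤ (1 + 2 * Real.log (1 + 1 / lam)) * Real.log (1 + T) := by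
  have hl : 0 < 1 / lam := by positivity
  have h1 : Real.log (1 + T / (K * lam)) ≤ Real.log ((1 + 1 / lam) * (1 + T)) := by
    refine Real.log_le_log (by positivity) ?_
    have h2 : T / (K * lam) ≤ T / lam :=
      div_le_div_of_nonneg_left (by linarith) hlam (by nlinarith)
    have h3 : T / lam = 1 / lam * T := by ring
    nlinarith
  rw [Real.log_mul (by positivity) (by positivity)] at h1
  have h4 : 0 ≤ Real.log (1 + 1 / lam) := Real.log_nonneg (by linarith)
  have h5 : Real.log 2 ≤ Real.log (1 + T) := Real.log_le_log (by norm_num) (by linarith)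
  have := Real.log_two_gt_d9
  nlinarith

theorem log_sq_div_add_eq {δ lam T K : ℝ} (hδ : 0 < δ) (hlam : 0 < lam) (hT : 0 < T)
    (hK : 0 < K) :
    Real.log (T ^ 2 / δ + T ^ 3 / (δ * lam * K)) =
      2 * Real.log T + (Real.log (1 / δ) + Real.log (1 + T / (K * lam))) := by
  rw [← log_inv_add_div_eq hδ hlam hT.le hK]
  have h1 : (2 : ℝ) * Real.log T = Real.log (T ^ 2) := by rw [Real.log_pow]; norm_num
  rw [h1, ← Real.log_mul (by positivity) (by positivity)]
  congr 1
  field_simp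

theorem sqrt_le_mul_of_le_sq {z a w : ℝ} (hw : 0 ≤ w) (h : z ≤ a * w ^ 2) :
    Real.sqrt z ≤ Real.sqrt a * w := by
  refine (Real.sqrt_le_sqrt h).trans (le_of_eq ?_)
  rw [Real.sqrt_mul' _ (sq_nonneg w), Real.sqrt_sq hw]

/-- Up to a constant, `tsG` is at most `√d log (1 + T) √(log N)`. -/
theorem exists_tsG_le (lam R C δ : ℝ) (hlam : 0 < lam) (hR : 0 ≤ R) (hδ : 0 < δ) (hδ1 : δ < 1) :
    ∃ G : ℝ, 0 ≤ G ∧ ∀ T d K N : ℕ, 1 ≤ T → 1 ≤ d → 1 ≤ K → 2 ≤ N →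
      tsG lam R C δ T d K N ≤
        G * (Real.sqrt d * Real.log (1 + T) * Real.sqrt (Real.log N)) := by
  set a := 2 * Real.log (1 / δ) + (1 + 2 * Real.log (1 + 1 / lam)) with ha
  have hlogδ : 0 < Real.log (1 / δ) := Real.log_pos (by rw [lt_div_iff₀ hδ]; linarith)
  refine ⟨4 * (R * Real.sqrt (3 * a) + 2 * |C|) + 4 * (R * Real.sqrt (2 + a)) + 8 * |C|,
    by positivity, fun T d K N hT hd hK hN => ?_⟩
  have hT1 : (1 : ℝ) ≤ T := by exact_mod_cast hT
  have hd1 : (1 : ℝ) ≤ d := by exact_mod_cast hd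
  have hK1 : (1 : ℝ) ≤ K := by exact_mod_cast hK
  have hN2 : (2 : ℝ) ≤ N := by exact_mod_cast hN
  have hl2 := Real.log_two_gt_d9
  have hu : Real.log 2 ≤ Real.log (1 + T) := Real.log_le_log (by norm_num) (by linarith)
  have hm : Real.log 2 ≤ Real.log N := Real.log_le_log (by norm_num) hN2
  have hTu : Real.log T ≤ Real.log (1 + T) := Real.log_le_log (by linarith) (by linarith)
  have hL := log_one_add_div_le hlam hT1 hK1
  have e1 := log_inv_add_div_eq hδ hlam (zero_le_one.trans hT1) (zero_lt_one.trans_le hK1)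
  have e2 := log_sq_div_add_eq hδ hlam (zero_lt_one.trans_le hT1) (zero_lt_one.trans_le hK1)
  have e3 : Real.log (T * N) = Real.log T + Real.log N :=
    Real.log_mul (by positivity) (by positivity)
  set u := Real.log (1 + (T : ℝ)) with hudef
  set m := Real.log (N : ℝ) with hmdef
  -- Square roots become variables so that the estimates are polynomial. The lower bounds 1/2, from
  -- log 2 > 1/4, let constants be multiplied by missing factors.
  obtain ⟨y, hy0, hy⟩ : ∃ y, 1 / 2 ≤ y ∧ y ^ 2 = u :=
    ⟨Real.sqrt u, Real.le_sqrt_of_sq_le (by linarith), Real.sq_sqrt (by linarith)⟩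
  obtain ⟨w, hw0, hw, hw'⟩ : ∃ w, 1 / 2 ≤ w ∧ w ^ 2 = m ∧ Real.sqrt m = w :=
    ⟨Real.sqrt m, Real.le_sqrt_of_sq_le (by linarith), Real.sq_sqrt (by linarith), rfl⟩
  obtain ⟨D, hD0, hD, hD'⟩ : ∃ D, 1 ≤ D ∧ D ^ 2 = (d : ℝ) ∧ Real.sqrt d = D :=
    ⟨Real.sqrt d, Real.le_sqrt_of_sq_le (by linarith), Real.sq_sqrt (by linarith), rfl⟩
  have hlogδu : Real.log (1 / δ) ≤ 2 * Real.log (1 / δ) * u := by nlinarith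
  have h1 : Real.sqrt (4 * Real.log (T * N)) ≤ 4 * (y * w) := by
    refine Real.sqrt_le_iff.mpr ⟨by positivity, ?_⟩
    rw [e3, mul_pow, mul_pow, hy, hw]
    nlinarith
  have h2 : Real.sqrt (3 * d * Real.log (1 / δ + T / (δ * lam * K))) ≤
      Real.sqrt (3 * a) * (D * y) := by
    refine sqrt_le_mul_of_le_sq (by positivity) ?_
    rw [e1, mul_pow, hy, hD]
    have h3 : Real.log (1 / δ) + Real.log (1 + T / (K * lam)) ≤ a * u := by
      rw [ha, add_mul]; linarith
    have := mul_le_mul_of_nonneg_left h3 (by positivity : (0 : ℝ) ≤ 3 * d)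
    linarith
  have h3 : Real.sqrt (d * Real.log ((T : ℝ) ^ 2 / δ + (T : ℝ) ^ 3 / (δ * lam * K))) ≤
      Real.sqrt (2 + a) * (D * y) := by
    refine sqrt_le_mul_of_le_sq (by positivity) ?_
    rw [e2, mul_pow, hy, hD]
    have h3 : 2 * Real.log T + (Real.log (1 / δ) + Real.log (1 + T / (K * lam))) ≤
        (2 + a) * u := by
      rw [ha, add_mul, add_mul]; linarith
    have := mul_le_mul_of_nonneg_left h3 (by positivity : (0 : ℝ) ≤ d)
    linarith
  rw [tsG, hD', hw', ← hy]
  have hs1 : 0 ≤ R * Real.sqrt (3 * a) := by positivity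
  have hs2 : 0 ≤ R * Real.sqrt (2 + a) := by positivity
  have hCabs := le_abs_self C
  have hC0 := abs_nonneg C
  have hw1 : 1 ≤ 2 * w := by linarith
  have hy1 : 1 ≤ 2 * y := by linarith
  have hDy : 1 ≤ 2 * (D * y) := by
    have := one_le_mul_of_one_le_of_one_le hD0 hy1
    linarith
  have hDy0 : 0 ≤ D * y := by positivity
  have k1 : R * Real.sqrt (3 * d * Real.log (1 / δ + T / (δ * lam * K))) + C ≤
      (R * Real.sqrt (3 * a) + 2 * |C|) * (D * y) := by
    have := mul_le_mul_of_nonneg_left h2 hR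
    have := mul_le_mul_of_nonneg_left hDy hC0
    linarith
  have k2 : Real.sqrt (4 * Real.log (T * N)) *
      (R * Real.sqrt (3 * d * Real.log (1 / δ + T / (δ * lam * K))) + C) ≤
      4 * (y * w) * ((R * Real.sqrt (3 * a) + 2 * |C|) * (D * y)) :=
    (mul_le_mul_of_nonneg_left k1 (Real.sqrt_nonneg _)).trans
      (mul_le_mul_of_nonneg_right h1 (by positivity))
  have k3 : 1 ≤ 4 * (y * w) := by
    have := one_le_mul_of_one_le_of_one_le hy1 hw1
    linarith
  have k4 : R * Real.sqrt (d * Real.log ((T : ℝ) ^ 2 / δ + (T : ℝ) ^ 3 / (δ * lam * K))) ≤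
      R * Real.sqrt (2 + a) * (D * y) * (4 * (y * w)) := by
    have h4 := mul_le_mul_of_nonneg_left h3 hR
    have h5 := mul_le_mul_of_nonneg_left k3 (mul_nonneg hs2 hDy0)
    linarith
  have k5 : C ≤ |C| * (2 * (D * y) * (4 * (y * w))) := by
    have h4 : 1 ≤ 2 * (D * y) * (4 * (y * w)) := one_le_mul_of_one_le_of_one_le hDy k3
    have h5 := mul_le_mul_of_nonneg_left h4 hC0
    linarith
  linarith

/-- The first term has the full order: √d log (1+T) √(log N) from `tsG` times √(dT log (1+T)). The
other terms lack factors that are bounded below. -/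
theorem exists_tsBound_le (lam R C δ : ℝ) (hlam : 0 < lam) (hR : 0 ≤ R) (hδ : 0 < δ)
    (hδ1 : δ < 1) :
    ∃ c : ℝ, ∀ T d K N : ℕ, 1 ≤ T → 1 ≤ d → 1 ≤ K → 2 ≤ N →
      tsBound lam R C δ T d K N ≤
        c * (d * Real.sqrt (T * Real.log N) * Real.log (1 + T) ^ (3 / 2 : ℝ)) := by
  obtain ⟨G, hG0, hG⟩ := exists_tsG_le lam R C δ hlam hR hδ hδ1
  have hp : 0 ≤ 1 / tsP := by linarith [nineteen_le_one_div_tsP]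
  set a := (2 + 2 * lam) / lam * (1 + 2 * Real.log (1 + 1 / lam)) with ha
  set k := (11 / Real.sqrt lam + 2) * Real.sqrt (2 * Real.log (2 / δ)) with hk
  have hk0 : 0 ≤ k := by positivity
  refine ⟨11 * (1 / tsP) * G * Real.sqrt a + 16 + 2 * (1 / tsP) * G * k,
    fun T d K N hT hd hK hN => ?_⟩
  have hg := hG T d K N hT hd hK hN
  have hT1 : (1 : ℝ) ≤ T := by exact_mod_cast hT
  have hd1 : (1 : ℝ) ≤ d := by exact_mod_cast hd
  have hK1 : (1 : ℝ) ≤ K := by exact_mod_cast hK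
  have hN2 : (2 : ℝ) ≤ N := by exact_mod_cast hN
  have hl2 := Real.log_two_gt_d9
  have hu : Real.log 2 ≤ Real.log (1 + T) := Real.log_le_log (by norm_num) (by linarith)
  have hm : Real.log 2 ≤ Real.log N := Real.log_le_log (by norm_num) hN2
  have hL := log_one_add_div_le hlam hT1 hK1
  have hpow : Real.log (1 + T) ^ (3 / 2 : ℝ) = Real.sqrt (Real.log (1 + T)) ^ 3 := by
    rw [Real.sqrt_eq_rpow, ← Real.rpow_natCast, ← Real.rpow_mul (by linarith)]
    norm_num
  rw [hpow, Real.sqrt_mul (Nat.cast_nonneg T)]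
  set u := Real.log (1 + (T : ℝ)) with hudef
  set m := Real.log (N : ℝ) with hmdef
  obtain ⟨y, hy0, hy, hy'⟩ : ∃ y, 1 / 2 ≤ y ∧ y ^ 2 = u ∧ Real.sqrt u = y :=
    ⟨Real.sqrt u, Real.le_sqrt_of_sq_le (by linarith), Real.sq_sqrt (by linarith), rfl⟩
  obtain ⟨w, hw0, hw'⟩ : ∃ w, 1 / 2 ≤ w ∧ Real.sqrt m = w :=
    ⟨Real.sqrt m, Real.le_sqrt_of_sq_le (by linarith), rfl⟩
  obtain ⟨D, hD0, hD, hD'⟩ : ∃ D, 1 ≤ D ∧ D ^ 2 = (d : ℝ) ∧ Real.sqrt d = D :=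
    ⟨Real.sqrt d, Real.le_sqrt_of_sq_le (by linarith), Real.sq_sqrt (by linarith), rfl⟩
  obtain ⟨t, ht0, ht, ht'⟩ : ∃ t, 1 ≤ t ∧ t ^ 2 = (T : ℝ) ∧ Real.sqrt T = t :=
    ⟨Real.sqrt T, Real.le_sqrt_of_sq_le (by linarith), Real.sq_sqrt (by linarith), rfl⟩
  have h1 : Real.sqrt ((2 + 2 * lam) / lam * d * T * Real.log (1 + T / (K * lam))) ≤
      Real.sqrt a * (D * t * y) := by
    refine sqrt_le_mul_of_le_sq (by positivity) ?_
    rw [mul_pow, mul_pow, hD, ht, hy, ha]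
    have := mul_le_mul_of_nonneg_left hL
      (by positivity : (0 : ℝ) ≤ (2 + 2 * lam) / lam * d * T)
    linarith
  have h2 : Real.sqrt (2 * T * Real.log (2 / δ)) = Real.sqrt (2 * Real.log (2 / δ)) * t := by
    rw [← ht', ← Real.sqrt_mul' _ (by linarith)]
    congr 1
    ring
  rw [hD', hw', ← hy] at hg
  rw [tsBound, h2, hy', hw', ht', ← hD]
  have hgp : tsG lam R C δ T d K N / tsP ≤ 1 / tsP * G * (D * y ^ 2 * w) := by
    rw [div_eq_mul_one_div, mul_comm, mul_assoc]
    exact mul_le_mul_of_nonneg_left hg hp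
  have hpG : 0 ≤ 1 / tsP * G := mul_nonneg hp hG0
  have k1 : 11 * tsG lam R C δ T d K N / tsP *
      Real.sqrt ((2 + 2 * lam) / lam * d * T * Real.log (1 + T / (K * lam))) ≤
      11 * (1 / tsP * G * (D * y ^ 2 * w)) * (Real.sqrt a * (D * t * y)) := by
    rw [mul_div_assoc]
    refine (mul_le_mul_of_nonneg_right (mul_le_mul_of_nonneg_left hgp (by norm_num))
      (Real.sqrt_nonneg _)).trans (mul_le_mul_of_nonneg_left h1 ?_)
    exact mul_nonneg (by norm_num) (mul_nonneg hpG (by positivity))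
  have hDD : 1 ≤ D ^ 2 := one_le_pow₀ hD0
  have hy3 : 1 ≤ 8 * y ^ 3 := by
    have : (1 / 2 : ℝ) ^ 3 ≤ y ^ 3 := pow_le_pow_left₀ (by norm_num) hy0 3
    linarith
  -- The constant 16 is 2 · 8, from w ≥ 1/2 and y³ ≥ 1/8.
  have k2 : 1 / (T : ℝ) ≤ 16 * (D ^ 2 * (t * w) * y ^ 3) := by
    have e1 : 1 / (T : ℝ) ≤ 1 := (div_le_one (by linarith)).mpr hT1
    have e2 : 1 ≤ D ^ 2 * t := one_le_mul_of_one_le_of_one_le hDD ht0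
    have e3 : 1 ≤ 2 * w * (8 * y ^ 3) := one_le_mul_of_one_le_of_one_le (by linarith) hy3
    have e4 := one_le_mul_of_one_le_of_one_le e2 e3
    linarith
  have k3 : tsG lam R C δ T d K N / tsP * (11 / Real.sqrt lam + 2) *
      (Real.sqrt (2 * Real.log (2 / δ)) * t) ≤
      2 * (1 / tsP) * G * k * (D ^ 2 * (t * w) * y ^ 3) := by
    have e1 : tsG lam R C δ T d K N / tsP * (11 / Real.sqrt lam + 2) *
        (Real.sqrt (2 * Real.log (2 / δ)) * t) = tsG lam R C δ T d K N / tsP * (k * t) := by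
      rw [hk]; ring
    rw [e1]
    refine (mul_le_mul_of_nonneg_right hgp (by positivity)).trans ?_
    have e2 : D * y ^ 2 * (w * t) ≤ D ^ 2 * (2 * y ^ 3) * (w * t) := by
      refine mul_le_mul_of_nonneg_right (mul_le_mul (le_self_pow₀ hD0 two_ne_zero) ?_
        (sq_nonneg y) (sq_nonneg D)) (by positivity)
      have := mul_le_mul_of_nonneg_left (by linarith : 1 ≤ 2 * y) (sq_nonneg y)
      linarith
    have e3 := mul_le_mul_of_nonneg_left e2 (mul_nonneg hpG hk0)
    linarith
  rw [← hD] at k1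
  linarith

theorem mainTheorem3 (lam R C δ : ℝ) (hlam : 0 < lam) (hR : 0 ≤ R) (hδ : 0 < δ) (hδ1 : δ < 1) :
    (∀ (A ι Ω : Type*) [Fintype A] [Nonempty A] [MeasurableSpace A] [MeasurableSingletonClass A]
        [Fintype ι] [DecidableEq ι] [MeasurableSpace Ω] (P : Measure Ω) [IsProbabilityMeasure P]
        (M : SpectralBandit A ι) (α : EuclideanSpace ℝ ι) (T : ℕ)
        (αs : ℕ → Ω → EuclideanSpace ℝ ι) (a : ℕ → Ω → A) (ε : ℕ → Ω → ℝ),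
        1 ≤ T → M.lamNorm lam α ≤ C → (∀ b, M.mean α b ∈ Set.Icc (-1 : ℝ) 1) →
        IsSpectralTSRun M lam R (tsScale lam R C δ T (M.effDim lam T) M.zeroMult) α T P αs a ε →
        1 - δ ≤ P.real {ω | M.regret α a T ω ≤
          tsBound lam R C δ T (M.effDim lam T) M.zeroMult (Fintype.card A)}) ∧
    (∃ c : ℝ, ∀ T d K N : ℕ, 1 ≤ T → 1 ≤ d → 1 ≤ K → 2 ≤ N →
      tsBound lam R C δ T d K N ≤
        c * (d * Real.sqrt (T * Real.log N) * Real.log (1 + T) ^ (3 / 2 : ℝ))) :=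
  ⟨fun _ _ _ _ _ _ _ _ _ _ _ _ _ _ _ _ _ _ hT hC _ hrun =>
    SpectralBandit.one_sub_le_measure_regret_le_tsBound hlam hR hδ hδ1 hT hC hrun,
    exists_tsBound_le lam R C δ hlam hR hδ hδ1⟩
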